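/- Let $\Omega\subset\mathbb R^2$ be a connected open set with Lipschitz boundary, and let $\Gamma$ be a one-dimensional Lipschitz submanifold of $\Omega$ consisting of finitely many disjoint arcs that lie in $\Omega$ except for their end points, which lie on $\partial\Omega$ (so $\partial\Gamma\subset\partial\Omega$). Let $T_\Gamma$ be the trace operator on $\Gamma$. For $\epsilon>0$ let $$W=\{u\in H^1_0(\Omega): T_\Gamma u\in H^1_0(\Gamma)\}\times H^1_0(\Gamma),\qquad Q=H^{-1}(\Gamma)=(H^1_0(\Gamma))^*,$$ $$\|(u,v)\|_W^2=|u|_{1,\Omega}^2+\epsilon^2|T_\Gamma u|_{1,\Gamma}^2+|v|_{1,\Gamma}^2,\qquad |u|_{1,D}=\|\nabla u\|_{L^2(D)},$$ and define $A:W\to W^*$, $B:W\to Q^*$ by $$\langle A(u,v),(\phi,\psi)\rangle=(\nabla u,\nabla\phi)_\Omega+(\nabla v,\nabla\psi)_\Gamma,\qquad \langle B(u,v),q\rangle=\langle q,\epsilon T_\Gamma u-v\rangle_\Gamma .$$ Let a finite conforming triangulation be given whose triangles have union $\overline\Omega_h\subset\overline\Omega$ and which is aligned with $\Gamma$, i.e.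 $\overline\Gamma$ is a union of edges of triangles. Let $U_h$ be the continuous functions on $\overline\Omega_h$ that are linear on every triangle (extended by zero to $\Omega\setminus\overline\Omega_h$), let $V_h$ be the continuous functions on $\overline\Gamma$ that are linear on every edge contained in $\overline\Gamma$, and put $$W_h=(U_h\cap H^1_0(\Omega))\times(V_h\cap H^1_0(\Gamma)),\qquad Q_h=V_h\cap H^1_0(\Gamma),$$ where $Q_h\subset Q$ through the $L^2(\Gamma)$ inner product. Let $A_h:W_h\to W_h^*$ and $B_h:W_h\to Q_h^*$ be the Galerkin operators, $\langle A_hw_h,\omega_h\rangle=\langle Aw_h,\omega_h\rangle$ and $\langle B_hw_h,q_h\rangle=\langle Bw_h,q_h\rangle$ for $w_h,\omega_h\in W_h$, $q_h\in Q_h$. Then there is a constant $\alpha>0$, independent of $\epsilon$ and of the triangulation (in particular of the mesh size $h$), such that for every $\epsilon>0$ and every such triangulation: $W_h\subset W$, $\ker B_h\subset\ker B$, and $$\langle A_hz_h,z_h\rangle\ \ge\ \alpha\,\|z_h\|_W^2\qquad\text{for all } z_h\in\ker B_h .$$ -/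

import Mathlib

open MeasureTheory Set Filter Topology
open scoped ContDiff ENNReal

noncomputable section

namespace TraceCoupling

/-! ### The spaces `L²`, `H¹₀` and `H⁻¹` -/

section Sobolev

variable {E : Type*} [NormedAddCommGroup E] [InnerProductSpace ℝ E] [FiniteDimensional ℝ E]
  [MeasurableSpace E] [BorelSpace E]

/-- `L²(D; F)` with respect to Lebesgue measure on `D`. -/
abbrev L2 (F : Type*) [NormedAddCommGroup F] (D : Set E) :=
  Lp F 2 ((volume : Measure E).restrict D)

/-- The pairs `(φ, ∇φ)` with `φ` smooth and compactly supported in `D`. -/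
def testGraph (D : Set E) : Submodule ℝ (L2 ℝ D × L2 E D) where
  carrier := {p | ∃ φ : E → ℝ, ContDiff ℝ ∞ φ ∧ HasCompactSupport φ ∧ tsupport φ ⊆ D ∧
    p.1 =ᵐ[volume.restrict D] φ ∧ p.2 =ᵐ[volume.restrict D] gradient φ}
  zero_mem' := by
    refine ⟨fun _ => 0, contDiff_const, HasCompactSupport.zero, ?_, Lp.coeFn_zero _ _ _, ?_⟩
    · simp [tsupport]
    · have h : gradient (fun _ : E => (0 : ℝ)) = 0 := by
        funext x; simp [gradient]
      rw [h]
      exact Lp.coeFn_zero _ _ _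
  add_mem' := by
    rintro p q ⟨φ, hφ, hφc, hφs, hp1, hp2⟩ ⟨ψ, hψ, hψc, hψs, hq1, hq2⟩
    refine ⟨φ + ψ, hφ.add hψ, hφc.add hψc, ?_, ?_, ?_⟩
    · exact (tsupport_add φ ψ).trans (union_subset hφs hψs)
    · exact (Lp.coeFn_add _ _).trans (hp1.add hq1)
    · have h : gradient (φ + ψ) = gradient φ + gradient ψ := by
        funext x
        simp only [gradient, Pi.add_apply]
        rw [fderiv_add (hφ.differentiable (by simp) x) (hψ.differentiable (by simp) x), map_add]
      rw [h]
      exact (Lp.coeFn_add _ _).trans (hp2.add hq2)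
  smul_mem' := by
    rintro c p ⟨φ, hφ, hφc, hφs, hp1, hp2⟩
    refine ⟨c • φ, contDiff_const.smul hφ, hφc.smul_left (f := fun _ => c), ?_, ?_, ?_⟩
    · exact (tsupport_smul_subset_right (fun _ => c) φ).trans hφs
    · exact (Lp.coeFn_smul _ _).trans (hp1.const_smul c)
    · have h : gradient (c • φ) = c • gradient φ := by
        funext x
        simp only [gradient, Pi.smul_apply]
        rw [fderiv_const_smul (hφ.differentiable (by simp) x)]
        simp
      rw [h]
      exact (Lp.coeFn_smul _ _).trans (hp2.const_smul c)

/-- `H¹₀(D)`: the closure, in the `H¹` topology, of the smooth functions with compact support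
in `D`.  An element is recorded as the pair (function, weak gradient) in `L² × L²`, whose product
topology is the topology of the `H¹` norm. -/
def H10 (D : Set E) : Submodule ℝ (L2 ℝ D × L2 E D) := (testGraph D).topologicalClosure

/-- The underlying `L²` function. -/
def H10.fn {D : Set E} : H10 D →L[ℝ] L2 ℝ D :=
  (ContinuousLinearMap.fst ℝ (L2 ℝ D) (L2 E D)).comp (H10 D).subtypeL

/-- The weak gradient. -/
def H10.grad {D : Set E} : H10 D →L[ℝ] L2 E D :=
  (ContinuousLinearMap.snd ℝ (L2 ℝ D) (L2 E D)).comp (H10 D).subtypeL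

/-- The `H¹₀` (semi)norm `|u|_{1,D} = ‖∇u‖_{L²(D)}`. -/
def H10.semi {D : Set E} (u : H10 D) : ℝ := ‖H10.grad u‖

/-- `(u, w) ↦ (∇u, ∇w)_D`. -/
def dirichletForm (D : Set E) : H10 D →ₗ[ℝ] H10 D →ₗ[ℝ] ℝ :=
  (innerₗ (L2 E D)).compl₁₂ (H10.grad (D := D) : H10 D →ₗ[ℝ] L2 E D)
    (H10.grad (D := D) : H10 D →ₗ[ℝ] L2 E D)

/-- `H⁻¹(D)`, the dual of `H¹₀(D)`. -/
abbrev Hneg (D : Set E) := StrongDual ℝ (H10 D)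

/-- The embedding of `H¹₀(D)` into `H⁻¹(D)` through the `L²` inner product:
`⟨q, p⟩ = (q, p)_D`. -/
def toHneg (D : Set E) : H10 D →ₗ[ℝ] Hneg D where
  toFun q := (innerSL ℝ (H10.fn q)).comp H10.fn
  map_add' p q := by ext x; simp
  map_smul' c q := by ext x; simp

end Sobolev

/-- A smooth compactly supported function is in `L²`. -/
theorem memLp_test {φ : ℝ → ℝ} (hφ : Continuous φ) (hc : HasCompactSupport φ) (I : Set ℝ) :
    MemLp φ 2 (volume.restrict I) :=
  (hφ.memLp_of_hasCompactSupport hc).restrict I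

/-- On an open subset of the line, an element of `H¹₀` is determined by its function. -/
theorem H10.ext_fn {I : Set ℝ} (hI : IsOpen I) {p q : H10 I} (h : H10.fn p = H10.fn q) :
    p = q := by
  have key : ∀ r : H10 I, H10.fn r = 0 → H10.grad r = 0 := by
    intro r hr
    have hint : ∀ g : ℝ → ℝ, ContDiff ℝ ∞ g → HasCompactSupport g → tsupport g ⊆ I →
        ∫ x, g x • (I.indicator (H10.grad r) x) = 0 := by
      intro g hg hgc hgs
      have hg' : Continuous (deriv g) := hg.continuous_deriv (by simp)
      have hgc' : HasCompactSupport (deriv g) := hgc.deriv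
      set G : L2 ℝ I := (memLp_test hg.continuous hgc I).toLp g with hG
      set G' : L2 ℝ I := (memLp_test hg' hgc' I).toLp (deriv g) with hG'
      have hclosed : IsClosed {z : L2 ℝ I × L2 ℝ I | inner ℝ G z.2 + inner ℝ G' z.1 = 0} :=
        isClosed_eq (by fun_prop) continuous_const
      have hsub : (testGraph I : Set (L2 ℝ I × L2 ℝ I)) ⊆
          {z | inner ℝ G z.2 + inner ℝ G' z.1 = 0} := by
        rintro z ⟨φ, hφ, hφc, hφs, h1, h2⟩
        have e1 : inner ℝ G z.2 = ∫ x, g x * deriv φ x := by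
          rw [L2.inner_def]
          have : ∫ x in I, inner ℝ (G x) (z.2 x) = ∫ x in I, g x * deriv φ x := by
            apply integral_congr_ae
            filter_upwards [h2, (memLp_test hg.continuous hgc I).coeFn_toLp] with x hx hx'
            rw [hx, hx', gradient_eq_deriv']
            simp [mul_comm]
          rw [this]
          apply setIntegral_eq_integral_of_forall_compl_eq_zero
          intro x hx
          rw [image_eq_zero_of_notMem_tsupport (fun h => hx (hgs h)), zero_mul]
        have e2 : inner ℝ G' z.1 = ∫ x, deriv g x * φ x := by
          rw [L2.inner_def]
          have : ∫ x in I, inner ℝ (G' x) (z.1 x) = ∫ x in I, deriv g x * φ x := by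
            apply integral_congr_ae
            filter_upwards [h1, (memLp_test hg' hgc' I).coeFn_toLp] with x hx hx'
            rw [hx, hx']
            simp [mul_comm]
          rw [this]
          apply setIntegral_eq_integral_of_forall_compl_eq_zero
          intro x hx
          rw [image_eq_zero_of_notMem_tsupport (fun h => hx (hφs h)), mul_zero]
        have hφ' : Continuous (deriv φ) := hφ.continuous_deriv (by simp)
        have parts : ∫ x, g x * deriv φ x = -∫ x, deriv g x * φ x := by
          apply integral_mul_deriv_eq_deriv_mul_of_integrable
          · exact fun x _ => (hg.differentiable (by simp) x).hasDerivAt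
          · exact fun x _ => (hφ.differentiable (by simp) x).hasDerivAt
          · exact (hg.continuous.mul hφ').integrable_of_hasCompactSupport hgc.mul_right
          · exact (hg'.mul hφ.continuous).integrable_of_hasCompactSupport hgc'.mul_right
          · exact (hg.continuous.mul hφ.continuous).integrable_of_hasCompactSupport hgc.mul_right
        show inner ℝ G z.2 + inner ℝ G' z.1 = 0
        rw [e1, e2, parts]; ring
      have hz : inner ℝ G (H10.grad r) + inner ℝ G' (H10.fn r) = 0 :=
        closure_minimal hsub hclosed r.2
      rw [hr, inner_zero_right, add_zero, L2.inner_def] at hz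
      have e3 : ∫ x, g x • (I.indicator (H10.grad r) x) = ∫ x in I, g x * H10.grad r x := by
        rw [← integral_indicator hI.measurableSet]
        congr 1
        funext x
        by_cases hx : x ∈ I <;> simp [hx]
      rw [e3, ← hz]
      apply integral_congr_ae
      filter_upwards [(memLp_test hg.continuous hgc I).coeFn_toLp] with x hx
      rw [hx]
      simp [mul_comm]
    have hloc : LocallyIntegrableOn (I.indicator (H10.grad r)) I volume := by
      have hL : MemLp (I.indicator (H10.grad r)) 2 (volume : Measure ℝ) :=
        (memLp_indicator_iff_restrict hI.measurableSet).2 (Lp.memLp _)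
      exact (hL.locallyIntegrable (by norm_num)).locallyIntegrableOn I
    have hae := hI.ae_eq_zero_of_integral_contDiff_smul_eq_zero hloc hint
    apply Lp.ext
    have : ∀ᵐ x ∂(volume.restrict I), H10.grad r x = 0 := by
      rw [ae_restrict_iff' hI.measurableSet]
      filter_upwards [hae] with x hx hxI
      simpa [hxI] using hx hxI
    filter_upwards [this, Lp.coeFn_zero ℝ 2 (volume.restrict I)] with x hx hx'
    rw [hx, hx']; rfl
  have h2 := key (p - q) (by rw [map_sub, h, sub_self])
  rw [map_sub, sub_eq_zero] at h2
  exact Subtype.ext (Prod.ext h h2)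

/-! ### The geometry -/

/-- The plane with the Euclidean norm. -/
abbrev Plane := EuclideanSpace ℝ (Fin 2)

/-- An open connected set which near each of its boundary points is, in suitable Cartesian
coordinates, the region above the graph of a Lipschitz function. -/
structure IsLipschitzDomain (Ω : Set Plane) : Prop where
  isOpen : IsOpen Ω
  isConnected : IsConnected Ω
  locally_graph : ∀ x ∈ frontier Ω, ∃ (e : Plane ≃ᵃⁱ[ℝ] Plane) (f : ℝ → ℝ) (L : NNReal) (r : ℝ),
    0 < r ∧ LipschitzWith L f ∧ ∀ y ∈ Metric.ball x r, y ∈ Ω ↔ f (e y 0) < e y 1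

/-- A one-dimensional Lipschitz submanifold `Γ` of `Ω` with boundary `∂Γ ⊆ ∂Ω`: finitely many
pairwise disjoint arcs, inside `Ω` except for their end points, which lie on `∂Ω`.  The arcs are
parametrised by arc length over disjoint compact intervals `[a i, b i]`. -/
structure Interface (Ω : Set Plane) where
  /-- the number of arcs is `n + 1` -/
  n : ℕ
  a : Fin (n + 1) → ℝ
  b : Fin (n + 1) → ℝ
  a_lt_b : ∀ i, a i < b i
  disjoint : Pairwise fun i j => Disjoint (Icc (a i) (b i)) (Icc (a j) (b j))
  γ : ℝ → Plane
  biLipschitz : ∃ c C : ℝ, 0 < c ∧ ∀ s ∈ ⋃ i, Icc (a i) (b i), ∀ t ∈ ⋃ i, Icc (a i) (b i),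
    c * |s - t| ≤ dist (γ s) (γ t) ∧ dist (γ s) (γ t) ≤ C * |s - t|
  unit_speed : ∀ᵐ s ∂(volume.restrict (⋃ i, Ioo (a i) (b i))), ‖deriv γ s‖ = 1
  mem_domain : ∀ i, ∀ s ∈ Ioo (a i) (b i), γ s ∈ Ω
  endpoints : ∀ i, γ (a i) ∈ frontier Ω ∧ γ (b i) ∈ frontier Ω

namespace Interface

variable {Ω : Set Plane} (Γ : Interface Ω)

/-- The open parameter set.  Functions on `Γ` are written in the arc length parameter: `L²(Γ)`,
`H¹₀(Γ)`, `H⁻¹(Γ)` are `L2 ℝ Γ.param`, `H10 Γ.param`, `Hneg Γ.param`. -/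
def param : Set ℝ := ⋃ i, Ioo (Γ.a i) (Γ.b i)

/-- The closure of `Γ` as a subset of the plane. -/
def closedCurve : Set Plane := Γ.γ '' ⋃ i, Icc (Γ.a i) (Γ.b i)

theorem isOpen_param : IsOpen Γ.param := isOpen_iUnion fun _ => isOpen_Ioo

/-- `g` is the trace of `u` on `Γ`: at almost every point `x` of `Γ` it is the limit of the means
of `u` over small discs around `x`.  For continuous `u` this is the restriction `u|_Γ`; for
`u ∈ H¹(Ω)` the limit exists almost everywhere on `Γ` and is the trace of `u`. -/
def IsTrace (u : L2 ℝ Ω) (g : L2 ℝ Γ.param) : Prop :=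
  ∀ᵐ s ∂(volume.restrict Γ.param),
    Tendsto (fun r : ℝ => ⨍ y in Metric.ball (Γ.γ s) r, u y ∂(volume.restrict Ω))
      (𝓝[>] 0) (𝓝 (g s))

variable {Γ}

theorem integrableOn_ball (u : L2 ℝ Ω) (x : Plane) (r : ℝ) :
    Integrable u ((volume.restrict Ω).restrict (Metric.ball x r)) := by
  have : IsFiniteMeasure ((volume.restrict Ω).restrict (Metric.ball x r)) := by
    refine ⟨?_⟩
    rw [Measure.restrict_apply_univ]
    exact (Measure.restrict_apply_le _ _).trans_lt measure_ball_lt_top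
  exact ((Lp.memLp u).restrict _).integrable (by norm_num)

theorem IsTrace.add {u v : L2 ℝ Ω} {f g : L2 ℝ Γ.param} (hu : Γ.IsTrace u f)
    (hv : Γ.IsTrace v g) : Γ.IsTrace (u + v) (f + g) := by
  filter_upwards [hu, hv, Lp.coeFn_add f g] with s h1 h2 h3
  rw [h3]
  refine (h1.add h2).congr fun r => ?_
  have hae : (↑(u + v) : Plane → ℝ) =ᵐ[(volume.restrict Ω).restrict (Metric.ball (Γ.γ s) r)]
      fun y => u y + v y := ae_restrict_of_ae (Lp.coeFn_add u v)
  rw [average_congr hae]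
  simp only [average_eq, smul_eq_mul]
  rw [integral_add (integrableOn_ball u _ _) (integrableOn_ball v _ _)]
  ring

theorem IsTrace.smul (c : ℝ) {u : L2 ℝ Ω} {f : L2 ℝ Γ.param} (hu : Γ.IsTrace u f) :
    Γ.IsTrace (c • u) (c • f) := by
  filter_upwards [hu, Lp.coeFn_smul c f] with s h1 h3
  rw [h3]
  refine (h1.const_mul c).congr fun r => ?_
  have hae : (↑(c • u) : Plane → ℝ) =ᵐ[(volume.restrict Ω).restrict (Metric.ball (Γ.γ s) r)]
      fun y => c * u y := ae_restrict_of_ae (Lp.coeFn_smul c u)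
  rw [average_congr hae]
  simp only [average_eq, smul_eq_mul]
  rw [integral_const_mul]
  ring

theorem IsTrace.zero : Γ.IsTrace 0 0 := by
  filter_upwards [Lp.coeFn_zero ℝ 2 (volume.restrict Γ.param)] with s h3
  rw [h3]
  refine tendsto_const_nhds.congr fun r => ?_
  have hae : (↑(0 : L2 ℝ Ω) : Plane → ℝ)
      =ᵐ[(volume.restrict Ω).restrict (Metric.ball (Γ.γ s) r)] fun _ => 0 :=
    ae_restrict_of_ae (Lp.coeFn_zero _ _ _)
  rw [average_congr hae]
  simp [average_eq]

theorem IsTrace.unique {u : L2 ℝ Ω} {f g : L2 ℝ Γ.param} (hf : Γ.IsTrace u f)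
    (hg : Γ.IsTrace u g) : f = g := by
  apply Lp.ext
  filter_upwards [hf, hg] with s h1 h2 using tendsto_nhds_unique h1 h2

variable (Γ)

/-! ### The continuous operators -/

/-- `U = H¹₀(Ω) ∩ ε H¹₀(Γ)` for `ε > 0`: the functions of `H¹₀(Ω)` whose trace on `Γ` lies in
`H¹₀(Γ)`.  (As a set the space does not depend on `ε`; its norm does.) -/
def U : Submodule ℝ (H10 Ω) where
  carrier := {u | ∃ g : H10 Γ.param, Γ.IsTrace (H10.fn u) (H10.fn g)}
  zero_mem' := ⟨0, by simpa using IsTrace.zero⟩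
  add_mem' := by
    rintro u v ⟨f, hf⟩ ⟨g, hg⟩
    exact ⟨f + g, by simpa using hf.add hg⟩
  smul_mem' := by
    rintro c u ⟨f, hf⟩
    exact ⟨c • f, by simpa using hf.smul c⟩

theorem eq_of_isTrace {u : L2 ℝ Ω} {f g : H10 Γ.param} (hf : Γ.IsTrace u (H10.fn f))
    (hg : Γ.IsTrace u (H10.fn g)) : f = g :=
  H10.ext_fn Γ.isOpen_param (hf.unique hg)

/-- The trace operator `T_Γ : U → H¹₀(Γ)`. -/
def trace : Γ.U →ₗ[ℝ] H10 Γ.param where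
  toFun u := u.2.choose
  map_add' u v := Γ.eq_of_isTrace (u + v).2.choose_spec
    (by simpa using u.2.choose_spec.add v.2.choose_spec)
  map_smul' c u := Γ.eq_of_isTrace (c • u).2.choose_spec
    (by simpa using u.2.choose_spec.smul c)

theorem isTrace_trace (u : Γ.U) : Γ.IsTrace (H10.fn (u : H10 Ω)) (H10.fn (Γ.trace u)) :=
  u.2.choose_spec

/-- `W = U × V = (H¹₀(Ω) ∩ ε H¹₀(Γ)) × H¹₀(Γ)`. -/
abbrev W := Γ.U × H10 Γ.param

/-- `Q = H⁻¹(Γ)`. -/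
abbrev Q := Hneg Γ.param

/-- The norm of `W`: `‖(u, v)‖² = |u|²_{1,Ω} + ε² |T_Γ u|²_{1,Γ} + |v|²_{1,Γ}`. -/
def normW (ε : ℝ) (w : Γ.W) : ℝ :=
  Real.sqrt (H10.semi (w.1 : H10 Ω) ^ 2 + ε ^ 2 * H10.semi (Γ.trace w.1) ^ 2
    + H10.semi w.2 ^ 2)

/-- `A`, given by `⟨A(u, v), (φ, ψ)⟩ = (∇u, ∇φ)_Ω + (∇v, ∇ψ)_Γ`. -/
def A : Γ.W →ₗ[ℝ] Γ.W →ₗ[ℝ] ℝ :=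
  (dirichletForm Ω).compl₁₂ (Γ.U.subtype ∘ₗ LinearMap.fst ℝ Γ.U (H10 Γ.param))
      (Γ.U.subtype ∘ₗ LinearMap.fst ℝ Γ.U (H10 Γ.param))
    + (dirichletForm Γ.param).compl₁₂ (LinearMap.snd ℝ Γ.U (H10 Γ.param))
      (LinearMap.snd ℝ Γ.U (H10 Γ.param))

/-- `B : W → Q*`, given by `⟨B(u, v), q⟩ = ⟨q, ε T_Γ u - v⟩_Γ` for `q ∈ Q = H⁻¹(Γ)`. -/
def B (ε : ℝ) : Γ.W →ₗ[ℝ] StrongDual ℝ Γ.Q :=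
  (NormedSpace.inclusionInDoubleDual ℝ (H10 Γ.param) :
      H10 Γ.param →ₗ[ℝ] StrongDual ℝ (StrongDual ℝ (H10 Γ.param)))
    ∘ₗ (ε • (Γ.trace ∘ₗ LinearMap.fst ℝ Γ.U (H10 Γ.param)) - LinearMap.snd ℝ Γ.U (H10 Γ.param))

theorem A_apply (w z : Γ.W) :
    Γ.A w z = inner ℝ (H10.grad (w.1 : H10 Ω)) (H10.grad (z.1 : H10 Ω))
      + inner ℝ (H10.grad w.2) (H10.grad z.2) := rfl

theorem B_apply (ε : ℝ) (w : Γ.W) (q : Γ.Q) : Γ.B ε w q = q (ε • Γ.trace w.1 - w.2) := rfl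

end Interface

/-! ### The discrete spaces and operators -/

/-- `φ` coincides on the simplex with vertex set `s` with a polynomial of degree at most one. -/
def IsP1On (φ : Plane → ℝ) (s : Finset Plane) : Prop :=
  ∃ p : Plane →ᵃ[ℝ] ℝ, EqOn φ p (convexHull ℝ (s : Set Plane))

/-- A triangulation: a finite simplicial complex in the plane all of whose simplices are faces of
triangles. The polygonal region `Ω̄_h ⊆ Ω̄` is the union of the triangles, and `Γ` is aligned with
the triangulation: its closure is the union of the edges that it contains. -/
structure IsMesh {Ω : Set Plane} (Γ : Interface Ω)
    (K : Geometry.SimplicialComplex ℝ Plane) : Prop where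
  finite : K.faces.Finite
  pure : ∀ s ∈ K.faces, ∃ t ∈ K.faces, s ⊆ t ∧ t.card = 3
  space_subset : K.space ⊆ closure Ω
  aligned : Γ.closedCurve = ⋃ e ∈ {e | e ∈ K.faces ∧ e.card = 2 ∧
    convexHull ℝ (e : Set Plane) ⊆ Γ.closedCurve}, convexHull ℝ (e : Set Plane)

namespace Interface

variable {Ω : Set Plane} (Γ : Interface Ω) (K : Geometry.SimplicialComplex ℝ Plane)

/-- `U_h ∩ H¹₀(Ω)`: the elements of `H¹₀(Ω)` given by a continuous function on `Ω̄_h` that is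
linear on every triangle (extended by zero to `Ω \ Ω̄_h`, if `Ω_h` is smaller than `Ω`). -/
def Uh : Submodule ℝ (H10 Ω) where
  carrier := {u | ∃ φ : Plane → ℝ, ContinuousOn φ K.space ∧
    (∀ t ∈ K.faces, t.card = 3 → IsP1On φ t) ∧
    H10.fn u =ᵐ[volume.restrict Ω] K.space.indicator φ}
  zero_mem' := by
    refine ⟨0, continuousOn_const, fun t _ _ => ⟨0, fun x _ => rfl⟩, ?_⟩
    rw [map_zero, show K.space.indicator (0 : Plane → ℝ) = 0 from indicator_zero' _]
    exact Lp.coeFn_zero _ _ _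
  add_mem' := by
    rintro u v ⟨φ, hφ, hφ1, hu⟩ ⟨ψ, hψ, hψ1, hv⟩
    refine ⟨φ + ψ, hφ.add hψ, fun t ht ht3 => ?_, ?_⟩
    · obtain ⟨p, hp⟩ := hφ1 t ht ht3
      obtain ⟨q, hq⟩ := hψ1 t ht ht3
      exact ⟨p + q, fun x hx => by simp [hp hx, hq hx]⟩
    · rw [map_add, indicator_add']
      exact (Lp.coeFn_add _ _).trans (hu.add hv)
  smul_mem' := by
    rintro c u ⟨φ, hφ, hφ1, hu⟩
    refine ⟨c • φ, hφ.const_smul c, fun t ht ht3 => ?_, ?_⟩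
    · obtain ⟨p, hp⟩ := hφ1 t ht ht3
      exact ⟨c • p, fun x hx => by simp [hp hx]⟩
    · rw [map_smul, show K.space.indicator (c • φ) = c • K.space.indicator φ by
        funext x; by_cases hx : x ∈ K.space <;> simp [hx]]
      exact (Lp.coeFn_smul _ _).trans (hu.const_smul c)

/-- `V_h ∩ H¹₀(Γ)`: the elements of `H¹₀(Γ)` given by a continuous function on the closure of `Γ`
that is linear on every edge of the triangulation contained in it. -/
def Vh : Submodule ℝ (H10 Γ.param) where
  carrier := {v | ∃ ψ : Plane → ℝ, ContinuousOn ψ Γ.closedCurve ∧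
    (∀ e ∈ K.faces, e.card = 2 → convexHull ℝ (e : Set Plane) ⊆ Γ.closedCurve → IsP1On ψ e) ∧
    H10.fn v =ᵐ[volume.restrict Γ.param] ψ ∘ Γ.γ}
  zero_mem' := by
    refine ⟨0, continuousOn_const, fun t _ _ _ => ⟨0, fun x _ => rfl⟩, ?_⟩
    rw [map_zero]
    exact Lp.coeFn_zero _ _ _
  add_mem' := by
    rintro u v ⟨φ, hφ, hφ1, hu⟩ ⟨ψ, hψ, hψ1, hv⟩
    refine ⟨φ + ψ, hφ.add hψ, fun t ht ht2 hts => ?_, ?_⟩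
    · obtain ⟨p, hp⟩ := hφ1 t ht ht2 hts
      obtain ⟨q, hq⟩ := hψ1 t ht ht2 hts
      exact ⟨p + q, fun x hx => by simp [hp hx, hq hx]⟩
    · rw [map_add]
      exact (Lp.coeFn_add _ _).trans (hu.add hv)
  smul_mem' := by
    rintro c u ⟨φ, hφ, hφ1, hu⟩
    refine ⟨c • φ, hφ.const_smul c, fun t ht ht2 hts => ?_, ?_⟩
    · obtain ⟨p, hp⟩ := hφ1 t ht ht2 hts
      exact ⟨c • p, fun x hx => by simp [hp hx]⟩
    · rw [map_smul]
      exact (Lp.coeFn_smul _ _).trans (hu.const_smul c)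

/-- `W_h = (U_h ∩ H¹₀(Ω)) × (V_h ∩ H¹₀(Γ))` as a subspace of `W`. -/
def Wh : Submodule ℝ Γ.W := ((Uh K).comap Γ.U.subtype).prod (Γ.Vh K)

/-- `Q_h = V_h ∩ H¹₀(Γ)`, which is embedded into `Q = H⁻¹(Γ)` by `toHneg`. -/
abbrev Qh : Submodule ℝ (H10 Γ.param) := Γ.Vh K

/-- The Galerkin operator `A_h : W_h → W_h*`, `⟨A_h w_h, ω_h⟩ = ⟨A w_h, ω_h⟩`. -/
def Ah : Γ.Wh K →ₗ[ℝ] Module.Dual ℝ (Γ.Wh K) := Γ.A.compl₁₂ (Γ.Wh K).subtype (Γ.Wh K).subtype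

/-- The Galerkin operator `B_h : W_h → Q_h*`, `⟨B_h w_h, q_h⟩ = ⟨B w_h, q_h⟩`. -/
def Bh (ε : ℝ) : Γ.Wh K →ₗ[ℝ] Module.Dual ℝ (Γ.Qh K) :=
  LinearMap.mk₂ ℝ (fun w q => Γ.B ε (w : Γ.W) (toHneg Γ.param (q : H10 Γ.param)))
    (fun w w' q => by simp) (fun c w q => by simp) (fun w q q' => by simp)
    (fun c w q => by simp)

end Interface

end TraceCoupling

end

namespace TraceCoupling

/-! ### One-dimensional `H¹₀` -/

/-! On the kernel the constraint `ε T_Γ u = v` holds, so the two interface terms in `‖(u, v)‖²`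
coincide. Then `‖(u, v)‖² = |u|² + 2|v|²`, while `⟨A(u, v), (u, v)⟩ = |u|² + |v|²`. Hence `α = 1/2`,
whatever `ε` and the mesh are (`Interface.half_normW_sq_le`).

For the discrete kernel, the point is that `ε T_Γ u_h - v_h` is itself an element of `Q_h`. Testing
`B_h z_h = 0` with this very element shows that its `L²(Γ)` norm vanishes, so the constraint holds
exactly and not only in a projected sense (`IsMesh.smul_trace_eq_of_mem_ker`).

Everything therefore rests on `IsMesh.exists_trace`: a finite element function of `H¹₀(Ω)` has a
trace in `V_h ∩ H¹₀(Γ)`. The candidate is the restriction of `φ` to `Γ`, which is piecewise affine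
on edges and hence Lipschitz in arc length. It belongs to `H¹₀(Γ)` once it vanishes at the end
points of the arcs (`exists_H10_of_lipschitzOnWith`).

Since `H¹₀(Ω)` is a closure of test functions, boundary values have to be extracted from it. This is
`IsMesh.eq_zero_of_notMem_interior`, which rests on a scaling argument (`jump_nonpos`). If `φ x ≠ 0`
at a boundary point of `Ω_h`, then on discs of radius `rδ` shrinking homothetically to `x`, one
family inside a triangle and one outside `Ω_h`, the integrals of `u` differ by at least a constant
times `r²`. Translating one disc onto the other costs at most a constant times `r²` times the `L²`
norm of `∇u` near `x`, and that norm tends to zero. The same vanishing makes the extension by zero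
continuous at the points of `Γ`, so that the disc means defining the trace converge to `φ`. -/

theorem gradient_eq_deriv_fun (φ : ℝ → ℝ) : gradient φ = deriv φ :=
  funext fun _ => gradient_eq_deriv'

theorem exists_Icc_of_isCompact_subset_Ioo {a b : ℝ} (hab : a < b) {S : Set ℝ} (hS : IsCompact S)
    (h : S ⊆ Ioo a b) : ∃ c d, a < c ∧ d < b ∧ S ⊆ Icc c d := by
  rcases S.eq_empty_or_nonempty with rfl | hne
  · exact ⟨b, a, hab, hab, empty_subset _⟩
  · exact ⟨sInf S, sSup S, (h (hS.sInf_mem hne)).1, (h (hS.sSup_mem hne)).2,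
      fun x hx => ⟨csInf_le hS.bddBelow hx, le_csSup hS.bddAbove hx⟩⟩

/-- A test function of mean zero is the derivative of a test function. -/
theorem exists_test_primitive {a b : ℝ} (hab : a < b) {g : ℝ → ℝ} (hg : ContDiff ℝ ∞ g)
    (hc : HasCompactSupport g) (hs : tsupport g ⊆ Ioo a b) (h0 : ∫ x, g x = 0) :
    ∃ φ : ℝ → ℝ, ContDiff ℝ ∞ φ ∧ HasCompactSupport φ ∧ tsupport φ ⊆ Ioo a b ∧ deriv φ = g := by
  obtain ⟨c, d, hac, hdb, hcd⟩ := exists_Icc_of_isCompact_subset_Ioo hab hc hs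
  -- With the support of `g` inside `[c, d]`, this primitive is zero left of `c` because `g` is, and
  -- zero right of `d` because the total integral of `g` is zero.
  set φ : ℝ → ℝ := fun x => ∫ t in a..x, g t with hφ
  have hder : ∀ x, HasDerivAt φ (g x) x := fun x =>
    intervalIntegral.integral_hasDerivAt_right (hg.continuous.intervalIntegrable _ _)
      (hg.continuous.stronglyMeasurableAtFilter _ _) hg.continuous.continuousAt
  have hdφ : deriv φ = g := funext fun x => (hder x).deriv
  have hzero : ∀ t, t ∉ Icc c d → g t = 0 := fun t ht =>
    image_eq_zero_of_notMem_tsupport fun h => ht (hcd h)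
  have hsupp : tsupport φ ⊆ Icc c d := by
    refine closure_minimal (fun x hx => ?_) isClosed_Icc
    by_contra hxn
    apply hx
    rw [mem_Icc, not_and_or, not_le, not_le] at hxn
    rcases hxn with hxc | hxd
    · show ∫ t in a..x, g t = 0
      apply intervalIntegral.integral_zero_ae
      refine ae_of_all _ fun t ht => hzero t fun h => ?_
      have := ht.2.trans (max_le hac.le hxc.le)
      have h1 : t = c := le_antisymm this h.1
      have := ht.2
      rw [h1] at this
      exact absurd this (not_le.2 (max_lt hac hxc))
    · show ∫ t in a..x, g t = 0
      rw [intervalIntegral.integral_eq_integral_of_support_subset, h0]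
      intro t ht
      have : t ∈ Icc c d := by
        by_contra h
        exact ht (hzero t h)
      exact ⟨hac.trans_le this.1, this.2.trans hxd.le⟩
  refine ⟨φ, ?_, isCompact_Icc.of_isClosed_subset (isClosed_tsupport _) hsupp, ?_, hdφ⟩
  · rw [contDiff_infty_iff_deriv, hdφ]
    exact ⟨fun x => (hder x).differentiableAt, hg⟩
  · exact hsupp.trans fun x hx => ⟨hac.trans_le hx.1, hx.2.trans_lt hdb⟩

theorem setIntegral_mul_test {I : Set ℝ} (k : L2 ℝ I) {g : ℝ → ℝ} (hg : Continuous g)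
    (hc : HasCompactSupport g) : inner ℝ k ((memLp_test hg hc I).toLp g) = ∫ x in I, k x * g x := by
  rw [L2.inner_def]
  apply integral_congr_ae
  filter_upwards [(memLp_test hg hc I).coeFn_toLp] with x hx
  rw [hx]
  simp [mul_comm]

theorem integrable_mul_test {I : Set ℝ} (k : L2 ℝ I) {g : ℝ → ℝ} (hg : Continuous g)
    (hc : HasCompactSupport g) : Integrable (fun x => k x * g x) (volume.restrict I) :=
  (Lp.memLp k).integrable_mul (memLp_test hg hc I)

/-- The functions of mean zero are limits of derivatives of test functions. -/
theorem mem_closure_deriv_test {a b : ℝ} (hab : a < b) (h : L2 ℝ (Ioo a b))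
    (h0 : ∫ x in Ioo a b, h x = 0) :
    h ∈ ((testGraph (Ioo a b)).map (LinearMap.snd ℝ (L2 ℝ (Ioo a b))
      (L2 ℝ (Ioo a b)))).topologicalClosure := by
  -- By duality it suffices that every `k` orthogonal to all derivatives of test functions is
  -- orthogonal to `h`. Such a `k` is constant (du Bois-Reymond), and `h` has mean zero.
  rw [← Submodule.orthogonal_orthogonal_eq_closure, Submodule.mem_orthogonal]
  intro k hk
  rw [Submodule.mem_orthogonal'] at hk
  let η : ContDiffBump ((a + b) / 2) :=
    ⟨(b - a) / 8, (b - a) / 4, by linarith, by linarith⟩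
  set e : ℝ → ℝ := η.normed volume with he
  have heC : ContDiff ℝ ∞ e := η.contDiff_normed
  have hec : HasCompactSupport e := η.hasCompactSupport_normed
  have hes : tsupport e ⊆ Ioo a b := by
    rw [he, η.tsupport_normed_eq]
    intro x hx
    rw [Metric.mem_closedBall, Real.dist_eq, abs_le] at hx
    have h4 : η.rOut = (b - a) / 4 := rfl
    rw [h4] at hx
    constructor <;> linarith [hx.1, hx.2]
  have hei : ∫ x, e x = 1 := η.integral_normed
  set c := ∫ x in Ioo a b, k x * e x with hc
  have key : ∀ g : ℝ → ℝ, ContDiff ℝ ∞ g → HasCompactSupport g → tsupport g ⊆ Ioo a b →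
      ∫ x in Ioo a b, k x * g x = c * ∫ x, g x := by
    intro g hg hgc hgs
    -- Subtracting `m e`, where `e` is a bump of integral one, makes `g` a derivative of a test
    -- function, to which `k` is orthogonal. This identifies `c = ∫ k e` as the constant value of
    -- `k`.
    set m := ∫ x, g x with hm
    set g₀ : ℝ → ℝ := fun x => g x - m * e x with hg0
    have hmc : HasCompactSupport fun x => m * e x := hec.mul_left
    have hg0C : ContDiff ℝ ∞ g₀ := hg.sub (contDiff_const.mul heC)
    have hg0c : HasCompactSupport g₀ := hgc.sub hmc
    have hg0s : tsupport g₀ ⊆ Ioo a b := by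
      refine (tsupport_sub g _).trans (union_subset hgs ?_)
      exact (tsupport_mul_subset_right (f := fun _ => m)).trans hes
    have hg0i : ∫ x, g₀ x = 0 := by
      rw [hg0, integral_sub (hg.continuous.integrable_of_hasCompactSupport hgc)
        ((heC.continuous.integrable_of_hasCompactSupport hec).const_mul m),
        integral_const_mul, hei]
      ring
    obtain ⟨φ, hφ, hφc, hφs, hφ'⟩ := exists_test_primitive hab hg0C hg0c hg0s hg0i
    have hmem : ((memLp_test hg0C.continuous hg0c (Ioo a b)).toLp g₀) ∈
        (testGraph (Ioo a b)).map (LinearMap.snd ℝ (L2 ℝ (Ioo a b)) (L2 ℝ (Ioo a b))) := by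
      refine ⟨((memLp_test hφ.continuous hφc (Ioo a b)).toLp φ,
        (memLp_test hg0C.continuous hg0c (Ioo a b)).toLp g₀), ⟨φ, hφ, hφc, hφs, ?_, ?_⟩, rfl⟩
      · exact MemLp.coeFn_toLp (memLp_test hφ.continuous hφc (Ioo a b))
      · show _ =ᵐ[_] gradient φ
        rw [gradient_eq_deriv_fun, hφ']
        exact MemLp.coeFn_toLp (memLp_test hg0C.continuous hg0c (Ioo a b))
    have h1 := hk _ hmem
    rw [setIntegral_mul_test k hg0C.continuous hg0c] at h1
    have h2 : ∫ x in Ioo a b, k x * g₀ x =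
        (∫ x in Ioo a b, k x * g x) - m * ∫ x in Ioo a b, k x * e x := by
      rw [← integral_const_mul, ← integral_sub (integrable_mul_test k hg.continuous hgc)
        ((integrable_mul_test k heC.continuous hec).const_mul m)]
      congr 1
      funext x
      simp only [hg0]
      ring
    rw [h2] at h1
    rw [hc]
    linarith
  have hloc : LocallyIntegrable (fun x => (Ioo a b).indicator k x - c) (volume : Measure ℝ) := by
    have hL : MemLp ((Ioo a b).indicator k) 2 (volume : Measure ℝ) :=
      (memLp_indicator_iff_restrict measurableSet_Ioo).2 (Lp.memLp _)
    exact (hL.locallyIntegrable (by norm_num)).sub (locallyIntegrable_const c)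
  have hae := isOpen_Ioo.ae_eq_zero_of_integral_contDiff_smul_eq_zero (U := (Ioo a b))
    (hloc.locallyIntegrableOn (Ioo a b)) fun g hg hgc hgs => by
      have e1 : ∀ x, g x • ((Ioo a b).indicator k x - c) =
          (Ioo a b).indicator (fun y => k y * g y) x - c * g x := by
        intro x
        by_cases hx : x ∈ Ioo a b
        · simp [hx]; ring
        · have : g x = 0 := image_eq_zero_of_notMem_tsupport fun h => hx (hgs h)
          simp [hx, this]
      simp_rw [e1]
      rw [integral_sub, integral_indicator measurableSet_Ioo, integral_const_mul,
        key g hg hgc hgs, sub_self]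
      · rw [integrable_indicator_iff measurableSet_Ioo]
        exact integrable_mul_test k hg.continuous hgc
      · exact (hg.continuous.integrable_of_hasCompactSupport hgc).const_mul c
  rw [L2.inner_def]
  have hkc : ∀ᵐ x ∂(volume.restrict (Ioo a b)), inner ℝ (k x) (h x) = c * h x := by
    rw [ae_restrict_iff' measurableSet_Ioo]
    filter_upwards [hae] with x hx hxI
    have := hx hxI
    rw [indicator_of_mem hxI] at this
    have h3 : k x = c := by linarith
    rw [h3]
    simp [mul_comm]
  rw [integral_congr_ae hkc, integral_const_mul, h0, mul_zero]

/-- A Lipschitz function on `[a, b]` that vanishes at the end points is in `H¹₀`. -/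
theorem exists_H10_of_lipschitzOnWith {D : Set ℝ} {a b : ℝ} (hab : a < b) (hD : Ioo a b ⊆ D)
    {w : ℝ → ℝ} {L : NNReal} (hw : LipschitzOnWith L w (Icc a b)) (ha : w a = 0) (hb : w b = 0) :
    ∃ p : H10 D, H10.fn p =ᵐ[volume.restrict D] (Ioo a b).indicator w := by
  set μ := (volume : Measure ℝ).restrict (Ioo a b) with hμ
  have hac : AbsolutelyContinuousOnInterval w a b := by
    apply LipschitzOnWith.absolutelyContinuousOnInterval (K := L)
    rwa [uIcc_of_le hab.le]
  have hwc : ContinuousOn w (Ioo a b) := hw.continuousOn.mono Ioo_subset_Icc_self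
  have hw'L : MemLp (deriv w) 2 μ := by
    apply MemLp.of_bound (measurable_deriv w).aestronglyMeasurable (L : ℝ)
    rw [hμ, ae_restrict_iff' measurableSet_Ioo]
    exact ae_of_all _ fun x hx => norm_deriv_le_of_lipschitzOn (Icc_mem_nhds hx.1 hx.2) hw
  have hwL : MemLp w 2 μ := by
    obtain ⟨C, hC⟩ := isCompact_Icc.exists_bound_of_continuousOn hw.continuousOn
    apply MemLp.of_bound (hwc.aestronglyMeasurable measurableSet_Ioo) C
    rw [ae_restrict_iff' measurableSet_Ioo]
    exact ae_of_all _ fun x hx => hC x (Ioo_subset_Icc_self hx)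
  have h0 : ∫ x in Ioo a b, hw'L.toLp (deriv w) x = 0 := by
    rw [integral_congr_ae hw'L.coeFn_toLp, ← integral_Ioc_eq_integral_Ioo,
      ← intervalIntegral.integral_of_le hab.le, hac.integral_deriv_eq_sub, ha, hb, sub_zero]
  -- The zero boundary values say that `w'` has mean zero, so test functions `φ n` exist with
  -- derivatives converging to `w'` in `L²`. Convergence of `φ n` to `w` follows by integrating from
  -- `a`.
  have hcl := mem_closure_deriv_test hab _ h0
  rw [← SetLike.mem_coe, Submodule.topologicalClosure_coe, mem_closure_iff_seq_limit] at hcl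
  obtain ⟨z, hzN, hz⟩ := hcl
  have hφ : ∀ n, ∃ φ : ℝ → ℝ, ContDiff ℝ ∞ φ ∧ HasCompactSupport φ ∧ tsupport φ ⊆ Ioo a b ∧
      z n =ᵐ[μ] deriv φ := by
    intro n
    obtain ⟨y, ⟨φ, h1, h2, h3, -, h5⟩, hy⟩ := hzN n
    refine ⟨φ, h1, h2, h3, ?_⟩
    rw [← hy, ← gradient_eq_deriv_fun]
    exact h5
  choose φ hφC hφc hφs hzφ using hφ
  have hφ'C : ∀ n, Continuous (deriv (φ n)) := fun n => (hφC n).continuous_deriv (by simp)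
  have hlim' : Tendsto (fun n => eLpNorm (deriv (φ n) - deriv w) 2 μ) atTop (𝓝 0) := by
    have := (Lp.tendsto_Lp_iff_tendsto_eLpNorm' z _).1 hz
    refine this.congr fun n => eLpNorm_congr_ae ?_
    exact (hzφ n).sub hw'L.coeFn_toLp
  have hmeas : ∀ n, AEStronglyMeasurable (deriv (φ n) - deriv w) μ := fun n =>
    (hφ'C n).aestronglyMeasurable.sub (measurable_deriv w).aestronglyMeasurable
  -- The first power of the length passes from the sup bound to `L²`; the second is Hölder's
  -- constant from `L¹` to `L²` for the derivatives.
  have hbound : ∀ n, eLpNorm (φ n - w) 2 μ ≤ μ univ ^ (2 : ℝ≥0∞).toReal⁻¹ *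
      μ univ ^ (1 / (1 : ℝ≥0∞).toReal - 1 / (2 : ℝ≥0∞).toReal) *
        eLpNorm (deriv (φ n) - deriv w) 2 μ := by
    intro n
    have hint : Integrable (deriv (φ n) - deriv w) μ :=
      (((memLp_test (hφ'C n) (hφc n).deriv _).sub hw'L).integrable (by norm_num))
    have hpt : ∀ᵐ x ∂μ, ‖(φ n - w) x‖ ≤ ∫ t, ‖(deriv (φ n) - deriv w) t‖ ∂μ := by
      rw [hμ, ae_restrict_iff' measurableSet_Ioo]
      refine ae_of_all _ fun x hx => ?_
      have hsub : uIcc a x ⊆ uIcc a b := by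
        rw [uIcc_of_le hab.le, uIcc_of_le hx.1.le]
        exact Icc_subset_Icc_right hx.2.le
      have e1 : ∫ t in a..x, deriv w t = w x - w a := (hac.mono hsub).integral_deriv_eq_sub
      have e2 : ∫ t in a..x, deriv (φ n) t = φ n x - φ n a :=
        intervalIntegral.integral_deriv_eq_sub
          (fun t _ => (hφC n).differentiable (by simp) t) ((hφ'C n).intervalIntegrable _ _)
      have e3 : φ n a = 0 := image_eq_zero_of_notMem_tsupport fun h => lt_irrefl a (hφs n h).1
      have hw'i : IntervalIntegrable (deriv w) volume a x :=
        (hac.mono hsub).intervalIntegrable_deriv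
      have e4 : (φ n - w) x = ∫ t in a..x, (deriv (φ n) - deriv w) t := by
        have := intervalIntegral.integral_sub ((hφ'C n).intervalIntegrable (μ := volume) a x) hw'i
        simp only [Pi.sub_apply]
        rw [this, e1, e2, e3, ha]
        ring
      rw [e4]
      refine (intervalIntegral.norm_integral_le_integral_norm hx.1.le).trans ?_
      rw [intervalIntegral.integral_of_le hx.1.le]
      apply setIntegral_mono_set (μ := volume) (s := Ioc a x) (t := Ioo a b) hint.norm
        (ae_of_all _ fun t => norm_nonneg _)
      exact (Ioc_subset_Ioo_right hx.2).eventuallyLE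
    refine (eLpNorm_le_of_ae_bound hpt).trans ?_
    rw [mul_assoc]
    gcongr
    rw [ofReal_integral_norm_eq_lintegral_enorm hint, ← eLpNorm_one_eq_lintegral_enorm, mul_comm]
    exact eLpNorm_le_eLpNorm_mul_rpow_measure_univ (by norm_num) (hmeas n)
  have hlim : Tendsto (fun n => eLpNorm (φ n - w) 2 μ) atTop (𝓝 0) := by
    refine tendsto_of_tendsto_of_tendsto_of_le_of_le tendsto_const_nhds ?_
      (fun n => zero_le) hbound
    have hfin : μ univ ^ (2 : ℝ≥0∞).toReal⁻¹ *
      μ univ ^ (1 / (1 : ℝ≥0∞).toReal - 1 / (2 : ℝ≥0∞).toReal) ≠ ⊤ := by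
      apply ENNReal.mul_ne_top <;>
        exact ENNReal.rpow_ne_top_of_nonneg (by norm_num) (measure_ne_top _ _)
    simpa using ENNReal.Tendsto.const_mul hlim' (Or.inr hfin)
  -- The `φ n` are supported in `(a, b)`, so extension by zero carries the convergence from `(a, b)`
  -- to all of `D`.
  have hext : ∀ f : ℝ → ℝ, MemLp f 2 μ →
      MemLp ((Ioo a b).indicator f) 2 (volume.restrict D) := fun f hf =>
    ((memLp_indicator_iff_restrict measurableSet_Ioo).2 hf).restrict D
  have hconv : ∀ (f : ℝ → ℝ) (hf : MemLp f 2 μ) (g : ℕ → ℝ → ℝ)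
      (hg : ∀ n, MemLp (g n) 2 (volume.restrict D)), (∀ n, ∀ x ∉ Ioo a b, g n x = 0) →
      Tendsto (fun n => eLpNorm (g n - f) 2 μ) atTop (𝓝 0) →
      Tendsto (fun n => (hg n).toLp (g n)) atTop (𝓝 ((hext f hf).toLp _)) := by
    intro f hf g hg hg0 hlim
    rw [Lp.tendsto_Lp_iff_tendsto_eLpNorm'']
    refine tendsto_of_tendsto_of_tendsto_of_le_of_le tendsto_const_nhds hlim
      (fun n => zero_le) fun n => ?_
    have : g n - (Ioo a b).indicator f = (Ioo a b).indicator (g n - f) := by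
      funext x
      by_cases hx : x ∈ Ioo a b
      · simp only [Pi.sub_apply, indicator_of_mem hx]
      · simp only [Pi.sub_apply, indicator_of_notMem hx, hg0 n x hx, sub_zero]
    rw [this, hμ, ← eLpNorm_indicator_eq_eLpNorm_restrict measurableSet_Ioo]
    exact eLpNorm_mono_measure _ Measure.restrict_le_self
  have hc1 := hconv w hwL φ (fun n => memLp_test (hφC n).continuous (hφc n) D)
    (fun n x hx => image_eq_zero_of_notMem_tsupport fun h => hx (hφs n h)) hlim
  have hc2 := hconv (deriv w) hw'L (fun n => deriv (φ n))
    (fun n => memLp_test (hφ'C n) (hφc n).deriv D)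
    (fun n x hx => image_eq_zero_of_notMem_tsupport
      fun h => hx (hφs n (tsupport_deriv_subset h))) hlim'
  refine ⟨⟨(_, _), mem_closure_of_tendsto (hc1.prodMk_nhds hc2) (Eventually.of_forall fun n =>
    ⟨φ n, hφC n, hφc n, (hφs n).trans hD,
      MemLp.coeFn_toLp (memLp_test (hφC n).continuous (hφc n) D), ?_⟩)⟩, ?_⟩
  · rw [gradient_eq_deriv_fun]
    exact MemLp.coeFn_toLp ((memLp_test (hφ'C n) (hφc n).deriv D))
  · exact (hext w hwL).coeFn_toLp

/-! ### Translation estimate in `H¹₀` -/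

section Translation

variable {E : Type*} [NormedAddCommGroup E] [InnerProductSpace ℝ E] [FiniteDimensional ℝ E]
  [MeasurableSpace E] [BorelSpace E]

theorem setIntegral_ball_add {F : Type*} [NormedAddCommGroup F] [NormedSpace ℝ F] (f : E → F)
    (p v : E) (ρ : ℝ) :
    ∫ y in Metric.ball p ρ, f (y + v) = ∫ y in Metric.ball (p + v) ρ, f y := by
  have h := (measurePreserving_add_right (volume : Measure E) v).setIntegral_preimage_emb
    (measurableEmbedding_addRight v) f (Metric.ball (p + v) ρ)
  rw [← h]
  congr 2
  ext y
  simp [dist_eq_norm]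

/-- Differentiating `t ↦ ∫ φ(y + t h)` over the fixed ball `B(p, ρ)` gives at most `‖h‖` times the
integral of `‖∇φ‖` over the translated ball, which lies in `T`; the mean value inequality on `[0,
1]` concludes. -/
theorem abs_integral_ball_sub_le_of_contDiff {φ : E → ℝ} (hφ : ContDiff ℝ 1 φ)
    (hc : HasCompactSupport φ) (p h : E) (ρ : ℝ) {T : Set E}
    (hT : ∀ t ∈ Icc (0 : ℝ) 1, Metric.ball (p + t • h) ρ ⊆ T) :
    |(∫ y in Metric.ball (p + h) ρ, φ y) - ∫ y in Metric.ball p ρ, φ y| ≤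
      ‖h‖ * ∫ y in T, ‖gradient φ y‖ := by
  have hn : ∀ y, ‖gradient φ y‖ = ‖fderiv ℝ φ y‖ := fun y => by simp [gradient]
  simp_rw [hn]
  have hfc : Continuous (fderiv ℝ φ) := hφ.continuous_fderiv (by simp)
  have hint : Integrable (fun y => ‖fderiv ℝ φ y‖) (volume : Measure E) :=
    hfc.norm.integrable_of_hasCompactSupport (hc.fderiv (𝕜 := ℝ)).norm
  obtain ⟨C, hC⟩ := (hc.fderiv (𝕜 := ℝ)).exists_bound_of_continuous hfc
  have hd : ∀ t : ℝ, HasDerivAt (fun t : ℝ => ∫ y in Metric.ball p ρ, φ (y + t • h))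
      (∫ y in Metric.ball p ρ, fderiv ℝ φ (y + t • h) h) t := by
    intro t
    have hcont : ∀ s : ℝ, Continuous fun y => φ (y + s • h) := fun s =>
      hφ.continuous.comp (by fun_prop)
    have hcont' : Continuous fun y => fderiv ℝ φ (y + t • h) h :=
      (hfc.comp (by fun_prop : Continuous fun y => y + t • h)).clm_apply continuous_const
    refine (hasDerivAt_integral_of_dominated_loc_of_deriv_le (s := univ)
      (bound := fun _ => C * ‖h‖) (F' := fun s y => fderiv ℝ φ (y + s • h) h) univ_mem
      (Eventually.of_forall fun s => (hcont s).aestronglyMeasurable) ?_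
      hcont'.aestronglyMeasurable ?_ ?_ ?_).2
    · exact ((hcont t).continuousOn.integrableOn_compact (isCompact_closedBall p ρ)).mono_set
        Metric.ball_subset_closedBall
    · exact ae_of_all _ fun y s _ => (ContinuousLinearMap.le_opNorm _ _).trans
        (mul_le_mul_of_nonneg_right (hC _) (norm_nonneg _))
    · exact integrableOn_const measure_ball_lt_top.ne
    · refine ae_of_all _ fun y s _ => ?_
      have h1 : HasDerivAt (fun s : ℝ => y + s • h) h s := by
        simpa using ((hasDerivAt_id s).smul_const h).const_add y
      exact ((hφ.differentiable (by simp) (y + s • h)).hasFDerivAt).comp_hasDerivAt s h1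
  have hb : ∀ t ∈ Ico (0 : ℝ) 1, ‖∫ y in Metric.ball p ρ, fderiv ℝ φ (y + t • h) h‖ ≤
      ‖h‖ * ∫ y in T, ‖fderiv ℝ φ y‖ := by
    intro t ht
    calc ‖∫ y in Metric.ball p ρ, fderiv ℝ φ (y + t • h) h‖
        ≤ ∫ y in Metric.ball p ρ, ‖fderiv ℝ φ (y + t • h)‖ * ‖h‖ := by
          apply norm_integral_le_of_norm_le
          · exact ((hint.comp_add_right (t • h)).mul_const _).integrableOn
          · exact ae_of_all _ fun y => ContinuousLinearMap.le_opNorm _ _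
      _ = ‖h‖ * ∫ y in Metric.ball (p + t • h) ρ, ‖fderiv ℝ φ y‖ := by
          rw [integral_mul_const, mul_comm, setIntegral_ball_add (fun y => ‖fderiv ℝ φ y‖)]
      _ ≤ ‖h‖ * ∫ y in T, ‖fderiv ℝ φ y‖ := by
          refine mul_le_mul_of_nonneg_left ?_ (norm_nonneg _)
          exact setIntegral_mono_set hint.integrableOn (ae_of_all _ fun y => norm_nonneg _)
            (hT t ⟨ht.1, ht.2.le⟩).eventuallyLE
  have := norm_image_sub_le_of_norm_deriv_le_segment_01'
    (fun t _ => (hd t).hasDerivWithinAt) hb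
  simp only [one_smul, zero_smul, add_zero] at this
  rwa [setIntegral_ball_add φ, Real.norm_eq_abs] at this

theorem integral_norm_le_sqrt_mul_norm {α F : Type*} [MeasurableSpace α] [NormedAddCommGroup F]
    {ν : Measure α}
    [IsFiniteMeasure ν] (g : Lp F 2 ν) : ∫ y, ‖g y‖ ∂ν ≤ √(ν.real univ) * ‖g‖ := by
  have hint : Integrable g ν := (Lp.memLp g).integrable (by norm_num)
  have h := eLpNorm_le_eLpNorm_mul_rpow_measure_univ (μ := ν) (p := 1) (q := 2) (by norm_num)
    (Lp.aestronglyMeasurable g)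
  rw [eLpNorm_one_eq_lintegral_enorm, ← ofReal_integral_norm_eq_lintegral_enorm hint] at h
  have hfin : eLpNorm g 2 ν * ν univ ^ (1 / (1 : ℝ≥0∞).toReal - 1 / (2 : ℝ≥0∞).toReal) ≠ ⊤ :=
    ENNReal.mul_ne_top (Lp.eLpNorm_ne_top g)
      (ENNReal.rpow_ne_top_of_nonneg (by norm_num) (measure_ne_top _ _))
  have h' := (ENNReal.ofReal_le_iff_le_toReal hfin).1 h
  rw [ENNReal.toReal_mul, ← Lp.norm_def, ← ENNReal.toReal_rpow] at h'
  rw [mul_comm, Real.sqrt_eq_rpow]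
  convert h' using 2
  norm_num [Measure.real]

theorem continuous_setIntegral_L2 {D : Set E} {S : Set E} (hS : MeasurableSet S)
    (hfin : volume S ≠ ⊤) : Continuous fun f : L2 ℝ D => ∫ y in S, f y ∂(volume.restrict D) := by
  have hfin' : (volume.restrict D) S ≠ ⊤ :=
    ((Measure.restrict_apply_le _ _).trans_lt hfin.lt_top).ne
  simp_rw [← L2.inner_indicatorConstLp_one hS hfin']
  fun_prop

/-- The integrals of an element of `H¹₀` over a ball and its translate differ at most by the
`L¹` norm of the gradient over a set that contains the balls in between. -/
theorem abs_integral_ball_sub_le {D : Set E} (u : H10 D) (p h : E) (ρ : ℝ) {T : Set E}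
    (hTm : MeasurableSet T) (hTf : volume T ≠ ⊤)
    (hT : ∀ t ∈ Icc (0 : ℝ) 1, Metric.ball (p + t • h) ρ ⊆ T) :
    |(∫ y in Metric.ball (p + h) ρ, H10.fn u y ∂(volume.restrict D)) -
        ∫ y in Metric.ball p ρ, H10.fn u y ∂(volume.restrict D)| ≤
      ‖h‖ * (√(volume.real T) *
        ‖LpToLpRestrictCLM E E ℝ (volume.restrict D) 2 T (H10.grad u)‖) := by
  -- Both sides are continuous in the pair (function, gradient), so the estimate passes from test
  -- functions to their closure.
  have hcl : IsClosed {z : L2 ℝ D × L2 E D |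
      |(∫ y in Metric.ball (p + h) ρ, z.1 y ∂(volume.restrict D)) -
        ∫ y in Metric.ball p ρ, z.1 y ∂(volume.restrict D)| ≤
      ‖h‖ * (√(volume.real T) * ‖LpToLpRestrictCLM E E ℝ (volume.restrict D) 2 T z.2‖)} := by
    have hb : ∀ q : E, Continuous fun z : L2 ℝ D × L2 E D =>
        ∫ y in Metric.ball q ρ, z.1 y ∂(volume.restrict D) := fun q =>
      (continuous_setIntegral_L2 measurableSet_ball measure_ball_lt_top.ne).comp continuous_fst
    exact isClosed_le ((hb _).sub (hb _)).abs (by fun_prop)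
  refine closure_minimal (s := (testGraph D : Set (L2 ℝ D × L2 E D))) ?_ hcl u.2
  rintro z ⟨φ, hφ, hφc, hφs, h1, h2⟩
  show |(∫ y in Metric.ball (p + h) ρ, z.1 y ∂(volume.restrict D)) -
    ∫ y in Metric.ball p ρ, z.1 y ∂(volume.restrict D)| ≤ _
  -- A test function vanishes off `D`, so the integrals restricted to `D` are full integrals even
  -- when the balls leave `D`.
  have e1 : ∀ q, ∫ y in Metric.ball q ρ, z.1 y ∂(volume.restrict D) =
      ∫ y in Metric.ball q ρ, φ y := by
    intro q
    rw [integral_congr_ae (ae_restrict_of_ae h1), Measure.restrict_comm measurableSet_ball]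
    exact setIntegral_eq_integral_of_forall_compl_eq_zero fun x hx =>
      image_eq_zero_of_notMem_tsupport fun h => hx (hφs h)
  rw [e1, e1]
  refine (abs_integral_ball_sub_le_of_contDiff (hφ.of_le (by simp)) hφc p h ρ hT).trans ?_
  gcongr
  have : IsFiniteMeasure ((volume.restrict D).restrict T) := by
    refine ⟨?_⟩
    rw [Measure.restrict_apply_univ]
    exact (Measure.restrict_apply_le _ _).trans_lt hTf.lt_top
  have e2 : ∫ y in T, ‖gradient φ y‖ = ∫ y, ‖LpToLpRestrictCLM E E ℝ (volume.restrict D) 2 T z.2 y‖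
      ∂((volume.restrict D).restrict T) := by
    have h3 : ∀ᵐ y ∂((volume.restrict D).restrict T),
        ‖LpToLpRestrictCLM E E ℝ (volume.restrict D) 2 T z.2 y‖ = ‖gradient φ y‖ := by
      filter_upwards [LpToLpRestrictCLM_coeFn ℝ T z.2, ae_restrict_of_ae h2] with y hy hy'
      rw [hy, hy']
    rw [integral_congr_ae h3, Measure.restrict_comm hTm]
    refine (setIntegral_eq_integral_of_forall_compl_eq_zero fun x hx => ?_).symm
    have : fderiv ℝ φ x = 0 := image_eq_zero_of_notMem_tsupport
      fun h => hx (hφs (tsupport_fderiv_subset ℝ h))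
    simp [gradient, this]
  rw [e2]
  refine (integral_norm_le_sqrt_mul_norm _).trans ?_
  gcongr
  rw [Measure.real, Measure.real, Measure.restrict_apply_univ]
  exact ENNReal.toReal_mono hTf (Measure.restrict_apply_le _ _)

/-- The `L²` norm over a small ball tends to zero with the radius. -/
theorem tendsto_norm_restrict_ball [Nontrivial E] {F : Type*} [NormedAddCommGroup F]
    [NormedSpace ℝ F] {D : Set E} (g : L2 F D) (x : E) (M : ℝ) :
    Tendsto (fun r : ℝ => ‖LpToLpRestrictCLM E F ℝ (volume.restrict D) 2
      (Metric.ball x (r * M)) g‖) (𝓝[>] 0) (𝓝 0) := by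
  have hvol : Tendsto (fun r : ℝ => (volume.restrict D) (Metric.ball x (r * M)))
      (𝓝[>] 0) (𝓝 0) := by
    have h1 : Tendsto (fun r : ℝ => volume (Metric.ball x (r * M))) (𝓝[>] 0) (𝓝 0) := by
      have h0 : Tendsto (fun r : ℝ => ENNReal.ofReal (r ^ Module.finrank ℝ E) *
          volume (Metric.ball (0 : E) M)) (𝓝[>] 0) (𝓝 0) := by
        have h3 : Tendsto (fun r : ℝ => ENNReal.ofReal (r ^ Module.finrank ℝ E))
            (𝓝[>] 0) (𝓝 0) := by
          have h4 : Continuous fun r : ℝ => ENNReal.ofReal (r ^ Module.finrank ℝ E) :=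
            ENNReal.continuous_ofReal.comp (by fun_prop)
          have h5 := h4.tendsto 0
          rw [zero_pow Module.finrank_pos.ne', ENNReal.ofReal_zero] at h5
          exact h5.mono_left nhdsWithin_le_nhds
        simpa using ENNReal.Tendsto.mul_const h3 (Or.inr measure_ball_lt_top.ne)
      refine h0.congr' ?_
      filter_upwards [self_mem_nhdsWithin] with r hr
      rw [Measure.addHaar_ball_mul_of_pos _ _ hr]
    exact tendsto_of_tendsto_of_tendsto_of_le_of_le tendsto_const_nhds h1 (fun _ => zero_le)
      fun r => Measure.restrict_apply_le _ _
  have hfin : ∫⁻ y, ‖g y‖ₑ ^ (2 : ℝ) ∂(volume.restrict D) ≠ ⊤ := by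
    have := (lintegral_rpow_enorm_lt_top_of_eLpNorm_lt_top (p := 2) (by norm_num) (by norm_num)
      (Lp.memLp g).2).ne
    simpa using this
  have h := tendsto_setLIntegral_zero hfin hvol
  have h2 : Tendsto (fun r : ℝ => eLpNorm g 2 ((volume.restrict D).restrict
      (Metric.ball x (r * M)))) (𝓝[>] 0) (𝓝 0) := by
    have h3 := (ENNReal.continuous_rpow_const (y := 1 / 2)).tendsto 0 |>.comp h
    rw [ENNReal.zero_rpow_of_pos (by norm_num)] at h3
    refine h3.congr fun r => ?_
    rw [eLpNorm_eq_lintegral_rpow_enorm_toReal (by norm_num) (by norm_num)]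
    simp
  have h4 := (ENNReal.tendsto_toReal ENNReal.zero_ne_top).comp h2
  refine h4.congr fun r => ?_
  rw [Lp.norm_def, eLpNorm_congr_ae (LpToLpRestrictCLM_coeFn ℝ _ g)]
  rfl

end Translation

/-! ### Functions in `H¹₀` have no jumps at conical points -/

section Jump

theorem ball_lineMap_eq_image {E : Type*} [NormedAddCommGroup E] [NormedSpace ℝ E]
    (x m : E) (δ : ℝ) {r : ℝ} (hr : 0 < r) :
    Metric.ball (AffineMap.lineMap x m r) (r * δ) =
      (fun y => AffineMap.lineMap x y r) '' Metric.ball m δ := by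
  have hd : ∀ y, dist (AffineMap.lineMap x y r) (AffineMap.lineMap x m r) = r * dist y m := by
    intro y
    have e : AffineMap.lineMap x y r - AffineMap.lineMap x m r = r • (y - m) := by
      simp only [AffineMap.lineMap_apply, vsub_eq_sub, vadd_eq_add]
      module
    rw [dist_eq_norm, e, norm_smul, Real.norm_of_nonneg hr.le, dist_eq_norm]
  ext z
  constructor
  · intro hz
    have hz' : AffineMap.lineMap x (AffineMap.lineMap x z r⁻¹) r = z := by
      simp [AffineMap.lineMap_apply, smul_inv_smul₀ hr.ne']
    refine ⟨AffineMap.lineMap x z r⁻¹, ?_, hz'⟩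
    rw [Metric.mem_ball, ← hz', hd] at hz
    exact lt_of_mul_lt_mul_left hz hr.le
  · rintro ⟨y, hy, rfl⟩
    rw [Metric.mem_ball, hd]
    exact mul_lt_mul_of_pos_left hy hr

variable {E : Type*} [NormedAddCommGroup E] [InnerProductSpace ℝ E] [FiniteDimensional ℝ E]
  [MeasurableSpace E] [BorelSpace E]

theorem volume_real_ball_mul (x : E) {r : ℝ} (hr : 0 < r) (s : ℝ) :
    volume.real (Metric.ball x (r * s)) =
      r ^ Module.finrank ℝ E * volume.real (Metric.ball (0 : E) s) := by
  rw [Measure.real, Measure.addHaar_ball_mul_of_pos _ _ hr, ENNReal.toReal_mul,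
    ENNReal.toReal_ofReal (by positivity)]
  rfl

/-- In dimension two, the means of a function of `H¹₀` over two discs that shrink to a point
homothetically cannot stay apart. -/
theorem jump_nonpos (hE : Module.finrank ℝ E = 2) {D : Set E} (u : H10 D) (x p q : E) {δ c : ℝ}
    (hδ : 0 < δ)
    (h : ∀ᶠ r : ℝ in 𝓝[>] 0, c * volume.real (Metric.ball x (r * δ)) ≤
      |(∫ y in Metric.ball (AffineMap.lineMap x q r) (r * δ), H10.fn u y ∂(volume.restrict D)) -
        ∫ y in Metric.ball (AffineMap.lineMap x p r) (r * δ), H10.fn u y ∂(volume.restrict D)|) :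
    c ≤ 0 := by
  have : Nontrivial E := Module.nontrivial_of_finrank_pos (R := ℝ) (by omega)
  -- At scale `r`, every disc on the way from the first to the second lies in the disc of radius
  -- `rM` around `x`.
  set M := ‖p - x‖ + ‖q - x‖ + δ with hM
  have hlim := (tendsto_norm_restrict_ball (H10.grad u) x M).const_mul
    (‖q - p‖ * √(volume.real (Metric.ball (0 : E) M)))
  rw [mul_zero] at hlim
  have hV : 0 < volume.real (Metric.ball (0 : E) δ) :=
    ENNReal.toReal_pos (Metric.measure_ball_pos _ _ hδ).ne' measure_ball_lt_top.ne
  have hle : c * volume.real (Metric.ball (0 : E) δ) ≤ 0 := by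
    refine ge_of_tendsto hlim ?_
    filter_upwards [h, self_mem_nhdsWithin] with r hr hr0
    have hr0 : 0 < r := hr0
    have hq : AffineMap.lineMap x q r = AffineMap.lineMap x p r + r • (q - p) := by
      simp only [AffineMap.lineMap_apply, vsub_eq_sub, vadd_eq_add]
      module
    have hT : ∀ t ∈ Icc (0 : ℝ) 1,
        Metric.ball (AffineMap.lineMap x p r + t • r • (q - p)) (r * δ) ⊆
          Metric.ball x (r * M) := by
      intro t ht
      apply Metric.ball_subset_ball'
      have e1 : AffineMap.lineMap x p r + t • r • (q - p) - x =
          r • ((1 - t) • (p - x) + t • (q - x)) := by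
        simp only [AffineMap.lineMap_apply, vsub_eq_sub, vadd_eq_add]
        module
      rw [dist_eq_norm, e1, norm_smul, Real.norm_of_nonneg hr0.le]
      have e2 : ‖(1 - t) • (p - x) + t • (q - x)‖ ≤ ‖p - x‖ + ‖q - x‖ := by
        refine (norm_add_le _ _).trans (add_le_add ?_ ?_)
        · rw [norm_smul, Real.norm_of_nonneg (by linarith [ht.2])]
          exact mul_le_of_le_one_left (norm_nonneg _) (by linarith [ht.1])
        · rw [norm_smul, Real.norm_of_nonneg ht.1]
          exact mul_le_of_le_one_left (norm_nonneg _) ht.2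
      rw [hM]
      nlinarith
    rw [hq] at hr
    have h1 := hr.trans (abs_integral_ball_sub_le u (AffineMap.lineMap x p r) (r • (q - p))
      (r * δ) measurableSet_ball measure_ball_lt_top.ne hT)
    -- Dimension two is critical: the area on the left is of order `r²`, and on the right one `r`
    -- comes from the translation and one from the square root of the area. After cancelling `r²`,
    -- only the vanishing gradient norm remains.
    rw [volume_real_ball_mul x hr0, volume_real_ball_mul x hr0, hE, norm_smul,
      Real.norm_of_nonneg hr0.le, Real.sqrt_mul (sq_nonneg r), Real.sqrt_sq hr0.le] at h1
    have hr2 : 0 < r ^ 2 := by positivity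
    refine le_of_mul_le_mul_left (le_trans (le_of_eq ?_) (h1.trans (le_of_eq ?_))) hr2
    · ring
    · ring
  by_contra hc
  push Not at hc
  exact absurd hle (not_le.2 (mul_pos hc hV))

end Jump

/-! ### Geometry of the triangulation -/

/-- A domain locally above a graph has no slits: just below a boundary point there is an open set
missing `Ω`, so the point is not interior to the closure. Together with `Ω̄_h ⊆ Ω̄`, this puts the
interior of `Ω̄_h` inside `Ω`. -/
theorem IsLipschitzDomain.interior_closure_subset {Ω : Set Plane} (hΩ : IsLipschitzDomain Ω) :
    interior (closure Ω) ⊆ Ω := by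
  intro x hx
  by_contra hxn
  have hxf : x ∈ frontier Ω := by
    rw [hΩ.isOpen.frontier_eq]
    exact ⟨interior_subset hx, hxn⟩
  obtain ⟨e, f, L, r, hr, hf, he⟩ := hΩ.locally_graph x hxf
  set y : ℝ → Plane := fun t => e.symm (e x - t • EuclideanSpace.single 1 1) with hy
  have hyc : Continuous y := e.symm.continuous.comp (by fun_prop)
  have hy0 : y 0 = x := by simp [hy]
  have hnhds : interior (closure Ω) ∩ Metric.ball x r ∈ 𝓝 (y 0) := by
    rw [hy0]
    exact inter_mem (isOpen_interior.mem_nhds hx) (Metric.ball_mem_nhds x hr)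
  have hev : ∀ᶠ t in 𝓝[>] (0 : ℝ), y t ∈ interior (closure Ω) ∩ Metric.ball x r :=
    (hyc.continuousAt.eventually_mem hnhds).filter_mono nhdsWithin_le_nhds
  obtain ⟨t, ⟨ht1, ht2⟩, ht0⟩ := (hev.and self_mem_nhdsWithin).exists
  have ht0 : 0 < t := ht0
  have hex : e x 1 ≤ f (e x 0) := by
    by_contra hlt
    exact hxn ((he x (Metric.mem_ball_self hr)).2 (not_le.1 hlt))
  have hO : IsOpen {z : Plane | e z 1 < f (e z 0)} := by
    have h1 : Continuous fun z : Plane => e z 1 := by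
      have := e.continuous
      fun_prop
    have h0 : Continuous fun z : Plane => e z 0 := by
      have := e.continuous
      fun_prop
    exact isOpen_lt h1 (hf.continuous.comp h0)
  have hyO : y t ∈ {z : Plane | e z 1 < f (e z 0)} := by
    simp only [mem_ofPred_eq, hy, e.apply_symm_apply]
    simp
    linarith
  have hN : {z : Plane | e z 1 < f (e z 0)} ∩ Metric.ball x r ∈ 𝓝 (y t) :=
    (hO.inter Metric.isOpen_ball).mem_nhds ⟨hyO, ht2⟩
  obtain ⟨z, ⟨hz1, hz2⟩, hzΩ⟩ := mem_closure_iff_nhds.1 (interior_subset ht1) _ hN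
  exact lt_asymm hz1 ((he z hz2).1 hzΩ)

theorem affineSpan_eq_top_of_card_eq_three {t : Finset Plane}
    (ht : AffineIndependent ℝ ((↑) : t → Plane)) (h3 : t.card = 3) :
    affineSpan ℝ (t : Set Plane) = ⊤ := by
  have := (ht.affineSpan_eq_top_iff_card_eq_finrank_add_one).2 (by simp [h3])
  simpa using this

/-- Near each of its points, and away from the others, a triangle is a cone. -/
theorem eventually_mem_triangle {t : Finset Plane} (ht : AffineIndependent ℝ ((↑) : t → Plane))
    (h3 : t.card = 3) (x : Plane) :
    ∀ᶠ y in 𝓝 x, ∀ r ∈ Ioc (0 : ℝ) 1,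
      AffineMap.lineMap x y r ∈ convexHull ℝ (t : Set Plane) → y ∈ convexHull ℝ (t : Set Plane) := by
  let b : AffineBasis t ℝ Plane := ⟨(↑), ht, by
    simpa using affineSpan_eq_top_of_card_eq_three ht h3⟩
  have hb : convexHull ℝ (t : Set Plane) = {z | ∀ i, 0 ≤ b.coord i z} := by
    rw [← b.convexHull_eq_nonneg_coord]
    congr
    exact Subtype.range_coe.symm
  rw [hb]
  have hi : ∀ i, ∀ᶠ y in 𝓝 x, ∀ r ∈ Ioc (0 : ℝ) 1,
      0 ≤ b.coord i (AffineMap.lineMap x y r) → 0 ≤ b.coord i y := by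
    intro i
    have hcont : Continuous (b.coord i) := (b.coord i).continuous_of_finiteDimensional
    have hl : ∀ y r, b.coord i (AffineMap.lineMap x y r) =
        (1 - r) * b.coord i x + r * b.coord i y := fun y r => by
      rw [AffineMap.apply_lineMap, AffineMap.lineMap_apply_module]
      simp
    -- A coordinate negative at `x` stays negative nearby, hence on the segment, and the premise
    -- fails. One that is zero at `x` is multiplied by `r`, so its sign is kept. One that is
    -- positive stays positive nearby.
    rcases lt_trichotomy (b.coord i x) 0 with hx | hx | hx
    · filter_upwards [hcont.continuousAt.eventually (gt_mem_nhds hx)] with y hy r hr h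
      rw [hl] at h
      nlinarith [hr.1, hr.2]
    · filter_upwards with y r hr h
      rw [hl, hx, mul_zero, zero_add] at h
      exact nonneg_of_mul_nonneg_right h hr.1
    · filter_upwards [hcont.continuousAt.eventually (lt_mem_nhds hx)] with y hy r hr h
      exact hy.le
  filter_upwards [eventually_all.2 hi] with y hy r hr h i using hy i r hr (h i)

section Mesh

variable {Ω : Set Plane} {Γ : Interface Ω} {K : Geometry.SimplicialComplex ℝ Plane}

theorem IsMesh.exists_triangle (hK : IsMesh Γ K) {x : Plane} (hx : x ∈ K.space) :
    ∃ t ∈ K.faces, t.card = 3 ∧ x ∈ convexHull ℝ (t : Set Plane) := by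
  obtain ⟨s, hs, hxs⟩ := Geometry.SimplicialComplex.mem_space_iff.1 hx
  obtain ⟨t, ht, hst, h3⟩ := hK.pure s hs
  exact ⟨t, ht, h3, convexHull_mono (Finset.coe_subset.2 hst) hxs⟩

theorem IsMesh.isClosed_space (hK : IsMesh Γ K) : IsClosed K.space := by
  unfold Geometry.SimplicialComplex.space
  exact hK.finite.isClosed_biUnion fun s _ => s.finite_toSet.isClosed_convexHull ℝ

/-- The contrapositive is what matters: if `y` near `x` lies outside `Ω̄_h`, so does the whole
segment from `x` to `y` except possibly `x`. Discs outside `Ω̄_h` can thus be shrunk towards `x`. -/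
theorem IsMesh.eventually_mem_space (hK : IsMesh Γ K) (x : Plane) :
    ∀ᶠ y in 𝓝 x, ∀ r ∈ Ioc (0 : ℝ) 1, AffineMap.lineMap x y r ∈ K.space → y ∈ K.space := by
  have h : ∀ᶠ y in 𝓝 x, ∀ t ∈ K.faces, t.card = 3 → ∀ r ∈ Ioc (0 : ℝ) 1,
      AffineMap.lineMap x y r ∈ convexHull ℝ (t : Set Plane) → y ∈ convexHull ℝ (t : Set Plane) := by
    rw [eventually_all_finite hK.finite]
    intro t ht
    by_cases h3 : t.card = 3
    · filter_upwards [eventually_mem_triangle (K.indep ht) h3 x] with y hy _ using hy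
    · exact Eventually.of_forall fun y h => absurd h h3
  filter_upwards [h] with y hy r hr hmem
  obtain ⟨t, ht, h3, hxt⟩ := hK.exists_triangle hmem
  exact Geometry.SimplicialComplex.convexHull_subset_space ht (hy t ht h3 r hr hxt)

theorem IsMesh.interior_space_subset (hK : IsMesh Γ K) (hΩ : IsLipschitzDomain Ω) :
    interior K.space ⊆ Ω :=
  (interior_mono hK.space_subset).trans hΩ.interior_closure_subset

/-! ### Boundary values of finite element functions in `H¹₀(Ω)` -/

theorem half_abs_mul_le_abs_setIntegral {α : Type*} [MeasurableSpace α] {μ : Measure α} {S : Set α}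
    (hS : μ S ≠ ⊤) {φ : α → ℝ} (hφ : IntegrableOn φ S μ) {c : ℝ}
    (hc : ∀ y ∈ S, ‖φ y - c‖ ≤ |c| / 2) : |c| / 2 * μ.real S ≤ |∫ y in S, φ y ∂μ| := by
  have hdiff : |(∫ y in S, φ y ∂μ) - c * μ.real S| ≤ |c| / 2 * μ.real S := by
    have h1 : (∫ y in S, φ y ∂μ) - c * μ.real S = ∫ y in S, (φ y - c) ∂μ := by
      rw [integral_sub hφ (integrableOn_const hS), setIntegral_const]
      simp [mul_comm]
    rw [h1]
    exact norm_setIntegral_le_of_norm_le_const hS.lt_top hc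
  have h2 : |c * μ.real S| = |c| * μ.real S := by
    rw [abs_mul, abs_of_nonneg measureReal_nonneg]
  have h3 := abs_sub_abs_le_abs_sub (c * μ.real S) (∫ y in S, φ y ∂μ)
  rw [abs_sub_comm (c * μ.real S)] at h3
  linarith

set_option maxHeartbeats 1000000 in
/-- A finite element function in `H¹₀(Ω)` vanishes on the boundary of `Ω_h`. -/
theorem IsMesh.eq_zero_of_notMem_interior (hK : IsMesh Γ K) (hΩ : IsLipschitzDomain Ω)
    (u : H10 Ω) {φ : Plane → ℝ} (hφ : ContinuousOn φ K.space)
    (hu : H10.fn u =ᵐ[volume.restrict Ω] K.space.indicator φ) {x : Plane} (hx : x ∈ K.space)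
    (hxi : x ∉ interior K.space) : φ x = 0 := by
  obtain ⟨t, ht, h3, hxt⟩ := hK.exists_triangle hx
  obtain ⟨m, hm⟩ := interior_convexHull_nonempty_iff_affineSpan_eq_top.2
    (affineSpan_eq_top_of_card_eq_three (K.indep ht) h3)
  obtain ⟨δ₁, hδ₁, hm⟩ := Metric.mem_nhds_iff.1 (isOpen_interior.mem_nhds hm)
  -- The cone property is needed on a whole disc around the exterior point `p`, not only at `p`.
  have hev := (hK.eventually_mem_space x).eventually_nhds
  have hfr : ∃ᶠ y in 𝓝 x, y ∉ K.space := fun h => hxi (mem_interior_iff_mem_nhds.2 (by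
    filter_upwards [h] with y hy using not_not.1 hy))
  obtain ⟨p, hp, hpev⟩ := (hfr.and_eventually hev).exists
  obtain ⟨δ₂, hδ₂, hp⟩ := Metric.mem_nhds_iff.1
    (inter_mem (hK.isClosed_space.isOpen_compl.mem_nhds hp) hpev)
  set δ := min δ₁ δ₂ with hδ
  have hδ0 : 0 < δ := lt_min hδ₁ hδ₂
  have hpball : ∀ r ∈ Ioc (0 : ℝ) 1,
      Metric.ball (AffineMap.lineMap x p r) (r * δ) ⊆ K.spaceᶜ := by
    intro r hr
    rw [ball_lineMap_eq_image x p δ hr.1]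
    rintro _ ⟨y, hy, rfl⟩ hmem
    have := hp (Metric.ball_subset_ball (min_le_right _ _) hy)
    exact this.1 (this.2 r hr hmem)
  have hmball : ∀ r ∈ Ioc (0 : ℝ) 1,
      Metric.ball (AffineMap.lineMap x m r) (r * δ) ⊆ convexHull ℝ (t : Set Plane) := by
    intro r hr
    rw [ball_lineMap_eq_image x m δ hr.1]
    rintro _ ⟨y, hy, rfl⟩
    have := interior_subset (hm (Metric.ball_subset_ball (min_le_left _ _) hy))
    exact (convex_convexHull ℝ _).lineMap_mem hxt this ⟨hr.1.le, hr.2⟩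
  have htK : convexHull ℝ (t : Set Plane) ⊆ K.space :=
    Geometry.SimplicialComplex.convexHull_subset_space ht
  have hpint : ∀ r ∈ Ioc (0 : ℝ) 1, ∫ y in Metric.ball (AffineMap.lineMap x p r) (r * δ),
      H10.fn u y ∂(volume.restrict Ω) = 0 := by
    intro r hr
    rw [integral_congr_ae (ae_restrict_of_ae hu)]
    exact setIntegral_eq_zero_of_forall_eq_zero fun y hy =>
      indicator_of_notMem (hpball r hr hy) _
  have hmint : ∀ r ∈ Ioc (0 : ℝ) 1, ∫ y in Metric.ball (AffineMap.lineMap x m r) (r * δ),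
      H10.fn u y ∂(volume.restrict Ω) = ∫ y in Metric.ball (AffineMap.lineMap x m r) (r * δ), φ y := by
    intro r hr
    have hsub : Metric.ball (AffineMap.lineMap x m r) (r * δ) ⊆ Ω :=
      (interior_maximal ((hmball r hr).trans htK) Metric.isOpen_ball).trans
        (hK.interior_space_subset hΩ)
    rw [integral_congr_ae (ae_restrict_of_ae hu), Measure.restrict_restrict measurableSet_ball,
      inter_eq_self_of_subset_left hsub]
    exact setIntegral_congr_fun measurableSet_ball fun y hy =>
      indicator_of_mem (htK (hmball r hr hy)) _
  by_contra hne
  have hpos : 0 < |φ x| / 2 := half_pos (abs_pos.2 hne)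
  obtain ⟨η, hη, hηφ⟩ := Metric.continuousOn_iff.1 hφ x hx _ hpos
  -- The integral over the exterior disc is zero, and over the interior disc `φ` is within `|φ x| /
  -- 2` of `φ x`; this is a persistent jump of size `|φ x| / 2`.
  refine absurd (jump_nonpos (by simp) u x p m (c := |φ x| / 2) hδ0 ?_) (not_le.2 hpos)
  have hsmall : ∀ᶠ r : ℝ in 𝓝[>] 0, r * (‖m - x‖ + δ) < η := by
    have : Tendsto (fun r : ℝ => r * (‖m - x‖ + δ)) (𝓝 0) (𝓝 0) := by
      have h : Continuous fun r : ℝ => r * (‖m - x‖ + δ) := by fun_prop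
      simpa using h.tendsto 0
    exact (this.eventually (gt_mem_nhds hη)).filter_mono nhdsWithin_le_nhds
  filter_upwards [hsmall, Ioc_mem_nhdsGT (zero_lt_one (α := ℝ))] with r hrs hr
  rw [hpint r hr, hmint r hr, sub_zero]
  set S := Metric.ball (AffineMap.lineMap x m r) (r * δ) with hS
  have hvol : volume.real (Metric.ball x (r * δ)) = volume.real S := by
    rw [hS, volume_real_ball_mul _ hr.1, volume_real_ball_mul _ hr.1]
  have hclose : ∀ y ∈ S, ‖φ y - φ x‖ ≤ |φ x| / 2 := by
    intro y hy
    refine (hηφ y (htK (hmball r hr hy)) ?_).le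
    have h1 : dist y x ≤ dist y (AffineMap.lineMap x m r) + dist (AffineMap.lineMap x m r) x :=
      dist_triangle _ _ _
    have h2 : dist (AffineMap.lineMap x m r) x = r * ‖m - x‖ := by
      rw [dist_lineMap_left, Real.norm_of_nonneg hr.1.le, dist_comm x m, dist_eq_norm]
    have h3 : dist y (AffineMap.lineMap x m r) < r * δ := hy
    linarith
  have hSφ : IntegrableOn φ S := by
    have hc : IsCompact (convexHull ℝ (t : Set Plane)) := t.finite_toSet.isCompact_convexHull ℝ
    exact ((hφ.mono htK).integrableOn_compact hc).mono_set (hmball r hr)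
  rw [hvol]
  exact half_abs_mul_le_abs_setIntegral measure_ball_lt_top.ne hSφ hclose

end Mesh

/-! ### Piecewise Lipschitz functions on an interval -/

/-- The pieces are arbitrary closed sets, such as preimages of simplices under `γ`, so there is no
subdivision into intervals to sum over. Instead, the estimate from `s` is propagated to the right: a
point `z` just after `y` lies only in pieces that also contain `y`, and the Lipschitz bound on a
common piece extends the estimate from `y` to `z`. -/
theorem exists_lipschitzOnWith_of_finite_cover {ι : Type*} {T : Set ι} (hT : T.Finite)
    {F : ι → Set ℝ} (hF : ∀ k ∈ T, IsClosed (F k)) {a b : ℝ} (hcov : Icc a b ⊆ ⋃ k ∈ T, F k)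
    {f : ℝ → ℝ} (hf : ContinuousOn f (Icc a b))
    (hL : ∀ k ∈ T, ∃ L : NNReal, LipschitzOnWith L f (F k ∩ Icc a b)) :
    ∃ L : NNReal, LipschitzOnWith L f (Icc a b) := by
  choose! M hM using hL
  obtain ⟨L, hLub⟩ := (hT.image M).bddAbove
  have hLip : ∀ k ∈ T, LipschitzOnWith L f (F k ∩ Icc a b) := fun k hk =>
    (hM k hk).weaken (hLub (mem_image_of_mem M hk))
  have key : ∀ s ∈ Icc a b, ∀ t ∈ Icc a b, s ≤ t → |f t - f s| ≤ L * (t - s) := by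
    intro s hs t ht hst
    have hsub : Icc s t ⊆ Icc a b := Icc_subset_Icc hs.1 ht.2
    have hcl : IsClosed ({y | |f y - f s| ≤ L * (y - s)} ∩ Icc s t) := by
      have := isClosed_Icc.isClosed_le (f := fun y => |f y - f s|)
        (g := fun y => (L : ℝ) * (y - s))
        (((hf.mono hsub).sub continuousOn_const).abs) (by fun_prop)
      convert this using 1
      ext y
      exact and_comm
    refine hcl.mem_of_ge_of_forall_exists_gt (by simp) hst fun y hy => ?_
    have hyab : y ∈ Icc a b := hsub (Ico_subset_Icc_self hy.2)
    have hev : ∀ᶠ z in 𝓝[>] y, ∀ k ∈ T, z ∈ F k → y ∈ F k := by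
      rw [eventually_all_finite hT]
      intro k hk
      by_cases hyk : y ∈ F k
      · exact Eventually.of_forall fun z _ => hyk
      · have : ∀ᶠ z in 𝓝 y, z ∉ F k := (hF k hk).isOpen_compl.mem_nhds hyk
        filter_upwards [this.filter_mono nhdsWithin_le_nhds] with z hz hzk using absurd hzk hz
    obtain ⟨z, hz, hzI⟩ := (hev.and (Ioc_mem_nhdsGT hy.2.2)).exists
    have hzab : z ∈ Icc a b := hsub ⟨hy.2.1.trans hzI.1.le, hzI.2⟩
    obtain ⟨k, hk, hzk⟩ := mem_iUnion₂.1 (hcov hzab)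
    have h1 := (hLip k hk).dist_le_mul z ⟨hzk, hzab⟩ y ⟨hz k hk hzk, hyab⟩
    rw [Real.dist_eq, Real.dist_eq, abs_of_pos (sub_pos.2 hzI.1)] at h1
    have h2 : |f y - f s| ≤ L * (y - s) := hy.1
    refine ⟨z, ?_, hzI⟩
    show |f z - f s| ≤ L * (z - s)
    have h3 := abs_sub_le (f z) (f y) (f s)
    linarith
  refine ⟨L, LipschitzOnWith.of_dist_le_mul fun s hs t ht => ?_⟩
  rw [Real.dist_eq, Real.dist_eq]
  rcases le_total s t with h | h
  · rw [abs_sub_comm, abs_sub_comm s t, abs_of_nonneg (sub_nonneg.2 h)]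
    exact key s hs t ht h
  · rw [abs_of_nonneg (sub_nonneg.2 h)]
    exact key t ht s hs h

theorem IsP1On.mono {φ : Plane → ℝ} {s t : Finset Plane} (h : IsP1On φ t) (hst : s ⊆ t) :
    IsP1On φ s := by
  obtain ⟨p, hp⟩ := h
  exact ⟨p, hp.mono (convexHull_mono (Finset.coe_subset.2 hst))⟩

theorem IsP1On.exists_lipschitzOnWith {φ : Plane → ℝ} {s : Finset Plane} (h : IsP1On φ s) :
    ∃ L : NNReal, LipschitzOnWith L φ (convexHull ℝ (s : Set Plane)) := by
  obtain ⟨p, hp⟩ := h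
  refine ⟨‖p.linear.toContinuousLinearMap‖₊, LipschitzOnWith.of_dist_le_mul fun x hx y hy => ?_⟩
  rw [hp hx, hp hy, dist_eq_norm, dist_eq_norm, ← vsub_eq_sub, ← p.linearMap_vsub]
  exact p.linear.toContinuousLinearMap.le_opNorm _

/-! ### Traces of finite element functions -/

theorem coeFn_sum_L2 {D : Set ℝ} {ι : Type*} (s : Finset ι) (f : ι → L2 ℝ D) :
    (↑(∑ i ∈ s, f i) : ℝ → ℝ) =ᵐ[volume.restrict D] fun x => ∑ i ∈ s, f i x := by
  classical
  induction s using Finset.induction_on with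
  | empty =>
    simp only [Finset.sum_empty]
    exact Lp.coeFn_zero _ _ _
  | insert i s hi ih =>
    simp only [Finset.sum_insert hi]
    exact (Lp.coeFn_add _ _).trans (EventuallyEq.rfl.add ih)

section Trace

variable {Ω : Set Plane} {Γ : Interface Ω} {K : Geometry.SimplicialComplex ℝ Plane}

theorem Interface.exists_lipschitzOnWith_γ (Γ : Interface Ω) :
    ∃ C : NNReal, LipschitzOnWith C Γ.γ (⋃ i, Icc (Γ.a i) (Γ.b i)) := by
  obtain ⟨c, C, -, h⟩ := Γ.biLipschitz
  refine ⟨C.toNNReal, LipschitzOnWith.of_dist_le_mul fun s hs t ht => ?_⟩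
  refine ((h s hs t ht).2).trans ?_
  rw [Real.dist_eq]
  gcongr
  exact Real.le_coe_toNNReal C

theorem IsMesh.closedCurve_subset (hK : IsMesh Γ K) : Γ.closedCurve ⊆ K.space := by
  rw [hK.aligned]
  exact iUnion₂_subset fun e he => Geometry.SimplicialComplex.convexHull_subset_space he.1

theorem Interface.γ_mem_closedCurve (Γ : Interface Ω) {i : Fin (Γ.n + 1)} {s : ℝ}
    (hs : s ∈ Icc (Γ.a i) (Γ.b i)) : Γ.γ s ∈ Γ.closedCurve :=
  mem_image_of_mem _ (mem_iUnion.2 ⟨i, hs⟩)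

/-- On small discs the values of `u` lie almost everywhere in a closed ball around `ψ (γ s)`, and by
convexity so does their mean. -/
theorem isTrace_of_continuousAt {u : L2 ℝ Ω} (hΩ : IsOpen Ω) {ψ : Plane → ℝ}
    (hu : u =ᵐ[volume.restrict Ω] ψ) (hψ : ∀ s ∈ Γ.param, ContinuousAt ψ (Γ.γ s))
    {g : L2 ℝ Γ.param} (hg : g =ᵐ[volume.restrict Γ.param] ψ ∘ Γ.γ) : Γ.IsTrace u g := by
  have hpar : ∀ᵐ s ∂(volume.restrict Γ.param), s ∈ Γ.param :=
    ae_restrict_mem Γ.isOpen_param.measurableSet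
  filter_upwards [hg, hpar] with s hs hsp
  rw [hs, Function.comp_apply, Metric.tendsto_nhds]
  intro ε hε
  have hx : Γ.γ s ∈ Ω := by
    obtain ⟨i, hi⟩ := mem_iUnion.1 hsp
    exact Γ.mem_domain i s hi
  obtain ⟨δ, hδ, hball⟩ := Metric.mem_nhds_iff.1 (inter_mem (hΩ.mem_nhds hx)
    ((hψ s hsp).eventually_mem (Metric.closedBall_mem_nhds _ (half_pos hε))))
  filter_upwards [Ioo_mem_nhdsGT hδ] with r hr
  have hsub : Metric.ball (Γ.γ s) r ⊆ Metric.ball (Γ.γ s) δ := Metric.ball_subset_ball hr.2.le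
  have hmem := (convex_closedBall (ψ (Γ.γ s)) (ε / 2)).set_average_mem
    (μ := volume.restrict Ω) (t := Metric.ball (Γ.γ s) r) (f := u) Metric.isClosed_closedBall
    (by
      rw [Measure.restrict_apply measurableSet_ball,
        inter_eq_self_of_subset_left fun y hy => (hball (hsub hy)).1]
      exact (Metric.measure_ball_pos _ _ hr.1).ne')
    ((Measure.restrict_apply_le _ _).trans_lt measure_ball_lt_top).ne
    (by
      filter_upwards [ae_restrict_of_ae hu, ae_restrict_mem measurableSet_ball] with y hy hyb
      rw [hy]
      exact (hball (hsub hyb)).2)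
    (Interface.integrableOn_ball u _ _)
  exact (Metric.mem_closedBall.1 hmem).trans_lt (half_lt_self hε)

/-- Extension by zero can only jump where `φ` is nonzero on the boundary of `S`. This covers points
of `Γ` that lie on the boundary of `Ω̄_h`. -/
theorem continuousAt_indicator_of_eq_zero {X : Type*} [TopologicalSpace X] {S : Set X}
    {φ : X → ℝ} (hφ : ContinuousOn φ S) {x : X} (hx : x ∈ S) (h : x ∉ interior S → φ x = 0) :
    ContinuousAt (S.indicator φ) x := by
  by_cases hxi : x ∈ interior S
  · have hS : S ∈ 𝓝 x := mem_interior_iff_mem_nhds.1 hxi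
    refine (hφ.continuousAt hS).congr ?_
    filter_upwards [hS] with y hy using (indicator_of_mem hy _).symm
  · have h0 := h hxi
    rw [ContinuousAt, indicator_of_mem hx, h0, Metric.tendsto_nhds]
    intro ε hε
    have h1 : ∀ᶠ y in 𝓝[S] x, dist (φ y) (φ x) < ε := Metric.tendsto_nhds.1 (hφ x hx) ε hε
    filter_upwards [eventually_nhdsWithin_iff.1 h1] with y hy
    by_cases hyS : y ∈ S
    · rw [indicator_of_mem hyS, ← h0]
      exact hy hyS
    · rwa [indicator_of_notMem hyS, dist_self]

set_option maxHeartbeats 1000000 in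
/-- A finite element function in `H¹₀(Ω)` has a trace, which is a finite element function in
`H¹₀(Γ)`. -/
theorem IsMesh.exists_trace (hK : IsMesh Γ K) (hΩ : IsLipschitzDomain Ω) {u : H10 Ω}
    (hu : u ∈ Interface.Uh K) : ∃ g ∈ Γ.Vh K, Γ.IsTrace (H10.fn u) (H10.fn g) := by
  obtain ⟨φ, hφ, hP1, huφ⟩ := hu
  have hzero : ∀ x ∈ K.space, x ∉ interior K.space → φ x = 0 := fun x hx hxi =>
    hK.eq_zero_of_notMem_interior hΩ u hφ huφ hx hxi
  have hP1e : ∀ e ∈ K.faces, IsP1On φ e := fun e he => by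
    obtain ⟨t, ht, het, h3⟩ := hK.pure e he
    exact (hP1 t ht h3).mono het
  have hmemK : ∀ i, ∀ s ∈ Icc (Γ.a i) (Γ.b i), Γ.γ s ∈ K.space := fun i s hs =>
    hK.closedCurve_subset (Γ.γ_mem_closedCurve hs)
  obtain ⟨C, hC⟩ := Γ.exists_lipschitzOnWith_γ
  have hCi : ∀ i, LipschitzOnWith C Γ.γ (Icc (Γ.a i) (Γ.b i)) := fun i =>
    hC.mono (subset_iUnion (fun i => Icc (Γ.a i) (Γ.b i)) i)
  have hbdry : ∀ x ∈ K.space, x ∈ frontier Ω → φ x = 0 := by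
    intro x hx hxf
    refine hzero x hx fun hxi => ?_
    rw [hΩ.isOpen.frontier_eq] at hxf
    exact hxf.2 (hK.interior_space_subset hΩ hxi)
  -- The parameter interval is covered by the preimages of all simplices; on each, `φ ∘ γ` is an
  -- affine function composed with a Lipschitz curve.
  have hLip : ∀ i, ∃ L : NNReal, LipschitzOnWith L (φ ∘ Γ.γ) (Icc (Γ.a i) (Γ.b i)) := by
    intro i
    refine exists_lipschitzOnWith_of_finite_cover hK.finite
      (F := fun e => Icc (Γ.a i) (Γ.b i) ∩ Γ.γ ⁻¹' convexHull ℝ (e : Set Plane)) ?_ ?_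
      (hφ.comp (hCi i).continuousOn (hmemK i)) ?_
    · exact fun e _ => (hCi i).continuousOn.preimage_isClosed_of_isClosed isClosed_Icc
        (e.finite_toSet.isClosed_convexHull ℝ)
    · intro s hs
      obtain ⟨e, he, hse⟩ := Geometry.SimplicialComplex.mem_space_iff.1 (hmemK i s hs)
      exact mem_iUnion₂.2 ⟨e, he, hs, hse⟩
    · intro e he
      obtain ⟨L, hL⟩ := (hP1e e he).exists_lipschitzOnWith
      exact ⟨L * C, hL.comp ((hCi i).mono inter_subset_right) fun s hs => hs.1.2⟩
  have hex : ∀ i, ∃ p : H10 Γ.param,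
      H10.fn p =ᵐ[volume.restrict Γ.param] (Ioo (Γ.a i) (Γ.b i)).indicator (φ ∘ Γ.γ) := by
    intro i
    obtain ⟨L, hL⟩ := hLip i
    exact exists_H10_of_lipschitzOnWith (Γ.a_lt_b i)
      (subset_iUnion (fun i => Ioo (Γ.a i) (Γ.b i)) i) hL
      (hbdry _ (hmemK i _ (left_mem_Icc.2 (Γ.a_lt_b i).le)) (Γ.endpoints i).1)
      (hbdry _ (hmemK i _ (right_mem_Icc.2 (Γ.a_lt_b i).le)) (Γ.endpoints i).2)
  choose p hp using hex
  -- Each arc contributes its extension by zero; the parameter intervals being disjoint, exactly one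
  -- summand is active at each parameter.
  have hg : H10.fn (∑ i, p i) =ᵐ[volume.restrict Γ.param] φ ∘ Γ.γ := by
    rw [map_sum]
    have hpar : ∀ᵐ s ∂(volume.restrict Γ.param), s ∈ Γ.param :=
      ae_restrict_mem Γ.isOpen_param.measurableSet
    filter_upwards [coeFn_sum_L2 Finset.univ fun i => H10.fn (p i), ae_all_iff.2 hp, hpar]
      with s hs hps hsp
    obtain ⟨i, hi⟩ := mem_iUnion.1 hsp
    rw [hs, Finset.sum_eq_single i, hps i, indicator_of_mem hi]
    · intro j _ hji
      rw [hps j, indicator_of_notMem]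
      exact fun hj => disjoint_left.1 (Γ.disjoint hji) (Ioo_subset_Icc_self hj)
        (Ioo_subset_Icc_self hi)
    · exact fun h => absurd (Finset.mem_univ i) h
  have hparK : ∀ s ∈ Γ.param, Γ.γ s ∈ K.space := fun s hs => by
    obtain ⟨i, hi⟩ := mem_iUnion.1 hs
    exact hmemK i s (Ioo_subset_Icc_self hi)
  refine ⟨∑ i, p i, ⟨φ, hφ.mono hK.closedCurve_subset, fun e he _ _ => hP1e e he, hg⟩, ?_⟩
  refine isTrace_of_continuousAt hΩ.isOpen huφ (fun s hs =>
    continuousAt_indicator_of_eq_zero hφ (hparK s hs) (hzero _ (hparK s hs))) (hg.trans ?_)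
  filter_upwards [ae_restrict_mem Γ.isOpen_param.measurableSet] with s hs
  simp only [Function.comp_apply, indicator_of_mem (hparK s hs)]

theorem IsMesh.trace_mem_Vh (hK : IsMesh Γ K) (hΩ : IsLipschitzDomain Ω) {u : Γ.U}
    (hu : (u : H10 Ω) ∈ Interface.Uh K) : Γ.trace u ∈ Γ.Vh K := by
  obtain ⟨g, hg, hgt⟩ := hK.exists_trace hΩ hu
  rwa [Γ.eq_of_isTrace (Γ.isTrace_trace u) hgt]

/-! ### The discrete kernel and coercivity on it -/

theorem eq_zero_of_forall_inner_fn {V : Submodule ℝ (H10 Γ.param)} {q : H10 Γ.param} (hq : q ∈ V)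
    (h : ∀ p : V, inner ℝ (H10.fn (p : H10 Γ.param)) (H10.fn q) = 0) : q = 0 :=
  H10.ext_fn Γ.isOpen_param ((inner_self_eq_zero.1 (h ⟨q, hq⟩)).trans (map_zero H10.fn).symm)

/-- The constraint holds exactly on the discrete kernel. -/
theorem IsMesh.smul_trace_eq_of_mem_ker (hK : IsMesh Γ K) (hΩ : IsLipschitzDomain Ω) {ε : ℝ}
    {z : Γ.Wh K} (hz : z ∈ LinearMap.ker (Γ.Bh K ε)) :
    ε • Γ.trace (z : Γ.W).1 - (z : Γ.W).2 = 0 := by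
  -- Pairing `B_h z` with `q` is the `L²(Γ)` product of `q` with the defect `ε T_Γ u - v`; as the
  -- defect lies in `V_h ∩ H¹₀(Γ)`, it is an admissible `q`.
  refine eq_zero_of_forall_inner_fn (V := Γ.Vh K) ?_ fun q => ?_
  · exact Submodule.sub_mem _ (Submodule.smul_mem _ _ (hK.trace_mem_Vh hΩ z.2.1)) z.2.2
  · exact LinearMap.congr_fun (LinearMap.mem_ker.1 hz) q

theorem Interface.mem_ker_B {ε : ℝ} {w : Γ.W} (h : ε • Γ.trace w.1 - w.2 = 0) :
    w ∈ LinearMap.ker (Γ.B ε) := by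
  rw [LinearMap.mem_ker]
  refine ContinuousLinearMap.ext fun q => ?_
  rw [Interface.B_apply, h, map_zero]
  rfl

theorem Interface.A_self (w : Γ.W) :
    Γ.A w w = H10.semi (w.1 : H10 Ω) ^ 2 + H10.semi w.2 ^ 2 := by
  rw [Interface.A_apply, real_inner_self_eq_norm_sq, real_inner_self_eq_norm_sq]
  rfl

theorem H10.semi_smul_sq {D : Set ℝ} (c : ℝ) (v : H10 D) :
    H10.semi (c • v) ^ 2 = c ^ 2 * H10.semi v ^ 2 := by
  rw [H10.semi, map_smul, norm_smul, mul_pow, Real.norm_eq_abs, sq_abs, H10.semi]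

/-- The constraint gives `ε² |T_Γ u|² = |v|²`, so half the squared norm is `|u|²/2 + |v|²`. -/
theorem Interface.half_normW_sq_le {ε : ℝ} {w : Γ.W} (h : ε • Γ.trace w.1 - w.2 = 0) :
    1 / 2 * Γ.normW ε w ^ 2 ≤ Γ.A w w := by
  have hs : H10.semi w.2 ^ 2 = ε ^ 2 * H10.semi (Γ.trace w.1) ^ 2 :=
    (congrArg (fun v => H10.semi v ^ 2) (sub_eq_zero.1 h).symm).trans (H10.semi_smul_sq _ _)
  have hn : Γ.normW ε w ^ 2 = H10.semi (w.1 : H10 Ω) ^ 2 +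
      ε ^ 2 * H10.semi (Γ.trace w.1) ^ 2 + H10.semi w.2 ^ 2 := Real.sq_sqrt (by positivity)
  have key : ∀ n a x y z : ℝ, n = x ^ 2 + y + z → z = y → a = x ^ 2 + z → 1 / 2 * n ≤ a :=
    fun n a x y z h1 h2 h3 => by linarith [sq_nonneg x]
  exact key _ _ _ _ _ hn hs (Interface.A_self w)

end Trace

end TraceCoupling


theorem mainTheorem8 (Ω : Set TraceCoupling.Plane) (hΩ : TraceCoupling.IsLipschitzDomain Ω)
    (Γ : TraceCoupling.Interface Ω) :
    ∃ α : ℝ, 0 < α ∧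
      ∀ (ε : ℝ), 0 < ε →
      ∀ (K : Geometry.SimplicialComplex ℝ TraceCoupling.Plane), TraceCoupling.IsMesh Γ K →
        TraceCoupling.Interface.Uh K ≤ Γ.U ∧
        (LinearMap.ker (Γ.Bh K ε)).map (Γ.Wh K).subtype ≤ LinearMap.ker (Γ.B ε) ∧
        ∀ z ∈ LinearMap.ker (Γ.Bh K ε),
          α * Γ.normW ε (z : Γ.W) ^ 2 ≤ Γ.Ah K z z := by
  refine ⟨1 / 2, by norm_num, fun ε _ K hK => ⟨fun u hu => ?_, ?_, fun z hz => ?_⟩⟩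
  · obtain ⟨g, -, hg⟩ := hK.exists_trace hΩ hu
    exact ⟨g, hg⟩
  · rintro _ ⟨z, hz, rfl⟩
    exact TraceCoupling.Interface.mem_ker_B (hK.smul_trace_eq_of_mem_ker hΩ hz)
  · exact TraceCoupling.Interface.half_normW_sq_le (hK.smul_trace_eq_of_mem_ker hΩ hz)
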